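/- All graphs are finite and simple. For a graph $G$ on $n$ vertices let $\lambda_1,\dots,\lambda_n$ be the eigenvalues of its adjacency matrix, $P_G(x)=\prod_{i=1}^n(x-\lambda_i)$ its characteristic polynomial and $\rho(G)=\max_i|\lambda_i|$ its spectral radius. The degree sequence of $G$ is the sequence of its vertex degrees, up to order. Let a rooted forest have $k$ levels (level $i$ consists of the vertices at distance $i-1$ from the root of their component), and let $(i_{h,1},\dots,i_{h,k_h})$ be the nonincreasing sequence of the degrees of the vertices at level $h$. The level greedy forest with this leveled degree sequence has vertices $g^h_1,\dots,g^h_{k_h}$ at level $h$ $(1\le h\le k)$, where $g^h_j$ has degree $i_{h,j}$ and the vertices of level $h+1$ are distributed in order as children of the vertices of level $h$: with $c_{1,m}=i_{1,m}$ and $c_{h,m}=i_{h,m}-1$ for $h\ge 2$, the children of $g^h_j$ are $g^{h+1}_r$ for $\sum_{m<j}c_{h,m}<r\le\sum_{m\le j}c_{h,m}$. A greedy tree is a tree in which a root can be chosen so that it becomes a (connected) level greedy forest with $\min_j i_{h,j}\ge\max_j i_{h+1,j}$ for all $1\le h<k$. Let $T$ be a tree with degree sequence $D$. Then there is a greedy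 tree $G(D)$ with degree sequence $D$, and for every such greedy tree $G(D)$ and every real $x>\rho(G(D))$, $$P_T(x)\ \ge\ P_{G(D)}(x),$$ with equality only if $T$ is isomorphic to $G(D)$. -/

import Mathlib

/-- The number of children of a vertex of degree `d` at level `h` of a rooted forest. Levels are
counted from `0`, the level of the roots; every vertex that is not a root has one parent. -/
def childCount (h d : ℕ) : ℕ := if h = 0 then d else d - 1

/-- `L` is the leveled degree sequence of a rooted forest: `L[h]` is the nonincreasing list of the
degrees of the vertices at level `h`, each vertex below the roots has degree at least one, and the
number of vertices at level `h + 1` is the total number of children of the vertices at level `h`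
(for the last level: there are no children). -/
structure IsLeveledDegreeSequence (L : List (List ℕ)) : Prop where
  level_ne_nil : ∀ l ∈ L, l ≠ []
  level_nonincreasing : ∀ l ∈ L, l.Pairwise (fun a b => b ≤ a)
  degree_pos : ∀ h : Fin L.length, 0 < (h : ℕ) → ∀ d ∈ L.get h, 1 ≤ d
  length_next : ∀ h : Fin L.length,
    (L.getD ((h : ℕ) + 1) []).length = ((L.get h).map (childCount h)).sum

/-- The vertices of the level greedy forest: `⟨h, j⟩` is the `j`-th vertex of level `h`
(both counted from `0`). -/
abbrev LevelVertex (L : List (List ℕ)) : Type :=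
  (h : Fin L.length) × Fin (L.get h).length

/-- `v` is a child of `u` in the level greedy forest: `v` lies one level below `u`, and the
vertices of that level are given, from left to right, to the vertices of the level of `u`, each of
them receiving as many consecutive ones as its assigned degree requires. -/
def IsGreedyChild (L : List (List ℕ)) (u v : LevelVertex L) : Prop :=
  (v.1 : ℕ) = (u.1 : ℕ) + 1 ∧
    (((L.get u.1).take (u.2 : ℕ)).map (childCount u.1)).sum ≤ (v.2 : ℕ) ∧
    (v.2 : ℕ) < (((L.get u.1).take ((u.2 : ℕ) + 1)).map (childCount u.1)).sum

/-- The level greedy forest with leveled degree sequence `L`. -/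
def levelGreedyForest (L : List (List ℕ)) : SimpleGraph (LevelVertex L) :=
  SimpleGraph.fromRel (IsGreedyChild L)

/-- A greedy tree: a tree which, for some choice of the root, is a level greedy tree such that
every degree at a level is at least every degree at the next level. -/
def IsGreedyTree {V : Type*} (G : SimpleGraph V) : Prop :=
  G.IsTree ∧ ∃ L : List (List ℕ), IsLeveledDegreeSequence L ∧
    L.IsChain (fun l l' => ∀ a ∈ l, ∀ b ∈ l', b ≤ a) ∧
    Nonempty (G ≃g levelGreedyForest L)

open Classical in
/-- The degree sequence of a finite graph (as a multiset, i.e. up to the order of its terms). -/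
noncomputable def degreeSequence {V : Type*} [Fintype V] (G : SimpleGraph V) : Multiset ℕ :=
  (Finset.univ : Finset V).val.map (fun v => G.degree v)

open Classical in
/-- The characteristic polynomial of (the adjacency matrix of) a finite graph. -/
noncomputable def graphCharpoly {V : Type*} [Fintype V] (G : SimpleGraph V) : Polynomial ℝ :=
  (G.adjMatrix ℝ).charpoly

open Classical in
/-- The spectral radius of a finite graph: the largest absolute value of an eigenvalue of the
adjacency matrix (all of them are real). -/
noncomputable def graphSpectralRadius {V : Type*} [Fintype V] (G : SimpleGraph V) : ENNReal :=
  spectralRadius ℝ (G.adjMatrix ℝ)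

/-! Fix `x` above all eigenvalues of all trees on `V` with degree sequence `D`, and let `T` minimize
the value at `x` of the characteristic polynomial among them. Then `M = x - A` is positive definite;
let `g = M⁻¹` be its Green matrix. Exchanging branches `A` at `u` with branches `B` at `p` is a
rank-two perturbation of `M`. With `a`, `b` the sums of `g v u / g u u` over `A` and of `g v p / g p
p` over `B`, it multiplies the determinant by `1 + (a - b)(g u u - g p p) - (a - b)² (g u u * g p p
- (g u p)²)` (`eval_graphCharpoly_exchange`). The last bracket is a positive minor, so minimality
forces `b ≤ a` whenever `g p p ≤ g u u` and the exchange preserves degrees up to order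
(`sum_le_sum`).

Hence the diagonal of `g` orders the vertices compatibly with their degrees, and the order passes to
neighbours off the path from `u` to `p`. These two properties (`IsGreedyWeight`) already make the
tree greedy: root it at a vertex of maximal weight and sort siblings by weight.

A greedy tree is determined by its degrees: read level by level they form the sorted sequence, and
each level fixes the size of the next. So every minimizer is isomorphic to `G`, which gives the
inequality and the equality case. To reach all `x > ρ(G)`, take the largest eigenvalue `m` among the
trees, attained by `S`: a limit from above gives `P_G(m) ≤ P_S(m) = 0`, so `m ≤ ρ(G)`. -/

/-! ### Distances in trees. -/

namespace SimpleGraph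

variable {V : Type*} {T : SimpleGraph V}

/-- A geodesic avoids every vertex that is farther from its end than its start is. -/
lemma Walk.notMem_support_of_dist_lt {u v r : V} (w : T.Walk u r) (hw : w.length = T.dist u r)
    (h : T.dist u r < T.dist v r) : v ∉ w.support := by
  classical
  intro hv
  have h1 := dist_le (w.dropUntil v hv)
  have h2 := w.length_dropUntil_le_length hv
  omega

lemma Connected.reachable_deleteEdges_of_dist_lt (hT : T.Connected) {u v r : V}
    (h : T.dist u r < T.dist v r) : (T.deleteEdges {s(u, v)}).Reachable u r := by
  obtain ⟨w, hw⟩ := hT.exists_walk_length_eq_dist u r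
  rw [reachable_deleteEdges_iff_exists_walk]
  exact ⟨w, fun he => w.notMem_support_of_dist_lt hw h (w.snd_mem_support_of_mem_edges he)⟩

/-- Distances across an edge of a tree add up. -/
lemma IsTree.dist_eq_of_adj_of_lt_of_lt (hT : T.IsTree) {u v p r : V} (huv : T.Adj u v)
    (hp : T.dist v p < T.dist u p) (hr : T.dist u r < T.dist v r) :
    T.dist r p = T.dist r u + 1 + T.dist v p := by
  classical
  have hb : T.IsBridge s(u, v) := isAcyclic_iff_forall_adj_isBridge.mp hT.isAcyclic huv
  obtain ⟨w, hw⟩ := hT.connected.exists_walk_length_eq_dist r p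
  -- A geodesic from `r` to `p` avoiding the bridge `uv` would still join `u` to `v` after its
  -- deletion.
  have hmem : s(u, v) ∈ w.edges := by
    by_contra hn
    apply isBridge_iff.mp hb
    have h1 := hT.connected.reachable_deleteEdges_of_dist_lt hr
    have h2 := hT.connected.reachable_deleteEdges_of_dist_lt hp
    rw [Sym2.eq_swap] at h2
    exact (h1.trans (reachable_deleteEdges_iff_exists_walk.mpr ⟨w, hn⟩)).trans h2.symm
  have hu := w.fst_mem_support_of_mem_edges hmem
  have h1 := dist_le (w.takeUntil u hu)
  have h2 := dist_le (w.dropUntil u hu)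
  have h3 := congrArg Walk.length (w.take_spec hu)
  rw [Walk.length_append] at h3
  have h4 := hT.connected.dist_triangle (u := r) (v := u) (w := p)
  have h5 := hT.dist_eq_dist_add_one_of_adj p huv
  rw [dist_comm (u := p), dist_comm (u := p)] at h5
  omega

lemma IsTree.dist_left_of_adj (hT : T.IsTree) {u v : V} (huv : T.Adj u v) (r : V) :
    T.dist u r = T.dist v r + 1 ∨ T.dist v r = T.dist u r + 1 := by
  have := hT.dist_eq_dist_add_one_of_adj r huv
  rwa [dist_comm (u := r), dist_comm (u := r)] at this

/-- The boundary of the side of `v` of an edge `uv` of a tree. -/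
lemma IsTree.eq_of_adj_of_side (hT : T.IsTree) {u v w z : V} (huv : T.Adj u v) (hwz : T.Adj w z)
    (hw : T.dist v w < T.dist u w) (hz : ¬ T.dist v z < T.dist u z) : w = v ∧ z = u := by
  have h1 : T.dist u z < T.dist v z := by
    have := hT.dist_left_of_adj huv z
    omega
  have h2 := hT.dist_eq_of_adj_of_lt_of_lt huv hw h1
  rw [dist_eq_one_iff_adj.mpr hwz.symm] at h2
  exact ⟨((hT.connected.dist_eq_zero_iff).mp (by omega)).symm,
    (hT.connected.dist_eq_zero_iff).mp (by omega)⟩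

lemma Connected.exists_adj_dist_succ (hT : T.Connected) {u r : V} (h : u ≠ r) :
    ∃ v, T.Adj u v ∧ T.dist u r = T.dist v r + 1 := by
  obtain ⟨w, hw⟩ := hT.exists_walk_length_eq_dist u r
  cases w with
  | nil => exact absurd rfl h
  | cons hadj w' =>
    rename_i v
    have h1 := hT.dist_triangle (u := u) (v := v) (w := r)
    rw [dist_eq_one_iff_adj.mpr hadj] at h1
    have h2 := dist_le w'
    rw [Walk.length_cons] at hw
    exact ⟨v, hadj, by omega⟩

/-- This is uniqueness of parents. If `a ≠ b`, then `b` lies on the side of `u` of the edge `ua`, so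
the path from `b` to `r` would cross that edge and be two longer than the one from `a`. -/
lemma IsTree.eq_of_adj_dist_succ (hT : T.IsTree) {u r a b : V} (ha : T.Adj u a) (hb : T.Adj u b)
    (har : T.dist u r = T.dist a r + 1) (hbr : T.dist u r = T.dist b r + 1) : a = b := by
  by_contra hab
  have h1 : T.dist u b < T.dist a b := by
    have h := hT.dist_left_of_adj ha b
    have h' := hT.connected.pos_dist_of_ne hab
    rw [dist_eq_one_iff_adj.mpr hb] at *
    omega
  have h2 := hT.dist_eq_of_adj_of_lt_of_lt ha (p := r) (r := b) (by omega) h1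
  omega

end SimpleGraph

/-! ### Branches of a positive definite matrix and rank-two updates. -/

namespace Matrix
open Finset

variable {n : Type*} [Fintype n] [DecidableEq n] {M : Matrix n n ℝ}

/-- `s` is attached to the rest of the matrix `M` only through the entry `M v u = -1`. -/
structure IsBranch (M : Matrix n n ℝ) (s : Set n) (u v : n) : Prop where
  mem : v ∈ s
  notMem : u ∉ s
  entry : M v u = -1
  entry_eq_zero : ∀ w ∈ s, ∀ z ∉ s, ¬ (w = v ∧ z = u) → M w z = 0

namespace IsBranch

variable {s : Set n} {u v : n}

-- Truncating `y` to `s` removes only the term `M v u * y u = -y u`, and only from row `v`.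
open Classical in
lemma mulVec_indicator (h : M.IsBranch s u v) {y : n → ℝ} {t : ℝ}
    (hy : ∀ w ∈ s, (M *ᵥ y) w = if w = v then t else 0) {w : n} (hw : w ∈ s) :
    (M *ᵥ s.indicator y) w = if w = v then t + y u else 0 := by
  have h1 : (M *ᵥ s.indicator y) w = (M *ᵥ y) w - ∑ z, M w z * (if z ∈ s then 0 else y z) := by
    simp only [mulVec, dotProduct, ← sum_sub_distrib]
    refine sum_congr rfl fun z _ => ?_
    by_cases hz : z ∈ s <;> simp [hz]
  have h2 : ∑ z, M w z * (if z ∈ s then 0 else y z) = if w = v then - y u else 0 := by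
    rw [sum_eq_single u]
    · split_ifs with h3 h4 h4
      · exact absurd h3 h.notMem
      · exact absurd h3 h.notMem
      · rw [h4, h.entry]; ring
      · rw [h.entry_eq_zero w hw u h.notMem (by tauto), zero_mul]
    · intro z _ hz
      split_ifs with h3
      · simp
      · rw [h.entry_eq_zero w hw z h3 (by tauto), zero_mul]
    · simp
  rw [h1, h2, hy w hw]
  split_ifs <;> ring

lemma dotProduct_mulVec_indicator (h : M.IsBranch s u v) {y : n → ℝ} {t : ℝ}
    (hy : ∀ w ∈ s, (M *ᵥ y) w = if w = v then t else 0) :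
    s.indicator y ⬝ᵥ (M *ᵥ s.indicator y) = y v * (t + y u) := by
  rw [dotProduct, sum_eq_single v]
  · rw [h.mulVec_indicator hy h.mem, Set.indicator_of_mem h.mem, if_pos rfl]
  · intro w _ hw
    by_cases hs : w ∈ s
    · rw [h.mulVec_indicator hy hs, if_neg hw, mul_zero]
    · rw [Set.indicator_of_notMem hs, zero_mul]
  · simp

lemma mul_pos_of_ne (h : M.IsBranch s u v) (hM : M.PosDef) {y : n → ℝ} {t : ℝ}
    (hy : ∀ w ∈ s, (M *ᵥ y) w = if w = v then t else 0) (ht : t + y u ≠ 0) :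
    0 < y v * (t + y u) := by
  rw [← h.dotProduct_mulVec_indicator hy]
  have hne : s.indicator y ≠ 0 := by
    intro h0
    have := h.mulVec_indicator hy h.mem
    rw [h0, mulVec_zero, if_pos rfl] at this
    exact ht this.symm
  simpa using hM.dotProduct_mulVec_pos hne

lemma eq_zero (h : M.IsBranch s u v) (hM : M.PosDef) {y : n → ℝ} {t : ℝ}
    (hy : ∀ w ∈ s, (M *ᵥ y) w = if w = v then t else 0) (ht : t + y u = 0) : y v = 0 := by
  by_contra hv
  have hne : s.indicator y ≠ 0 := by
    intro h0
    have := congrFun h0 v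
    rw [Set.indicator_of_mem h.mem] at this
    exact hv this
  have h1 := hM.dotProduct_mulVec_pos hne
  rw [star_trivial, h.dotProduct_mulVec_indicator hy, ht, mul_zero] at h1
  exact lt_irrefl _ h1

/-- A solution on the branch is driven by the single number `t + y u`; the combination of two
solutions in which this number cancels vanishes at `v`. -/
lemma mul_eq_mul (h : M.IsBranch s u v) (hM : M.PosDef) {y y' : n → ℝ} {t t' : ℝ}
    (hy : ∀ w ∈ s, (M *ᵥ y) w = if w = v then t else 0)
    (hy' : ∀ w ∈ s, (M *ᵥ y') w = if w = v then t' else 0) :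
    (t' + y' u) * y v = (t + y u) * y' v := by
  have h1 := h.eq_zero hM (y := (t' + y' u) • y - (t + y u) • y')
    (t := (t' + y' u) * t - (t + y u) * t') (by
      intro w hw
      rw [mulVec_sub, mulVec_smul, mulVec_smul, Pi.sub_apply, Pi.smul_apply, Pi.smul_apply,
        hy w hw, hy' w hw]
      split_ifs <;> simp) (by simp only [Pi.sub_apply, Pi.smul_apply, smul_eq_mul]; ring)
  simp only [Pi.sub_apply, Pi.smul_apply, smul_eq_mul] at h1
  linarith

lemma mulVec_inv (hM : M.PosDef) (z w : n) :
    (M *ᵥ fun i => M⁻¹ i z) w = if w = z then 1 else 0 := by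
  have h1 : M * M⁻¹ = 1 := M.mul_nonsing_inv ((isUnit_iff_isUnit_det _).mp hM.isUnit)
  rw [← one_apply, ← h1]
  rfl

lemma inv_pos (h : M.IsBranch s u v) (hM : M.PosDef) : 0 < M⁻¹ v u := by
  have hu := hM.inv.diag_pos (i := u)
  have h1 := h.mul_pos_of_ne hM (y := fun i => M⁻¹ i u) (t := 0) (fun w hw => by
    rw [mulVec_inv hM, if_neg (fun e : w = u => h.notMem (e ▸ hw)), ite_self])
    (by simpa using hu.ne')
  rw [zero_add] at h1
  exact (pos_iff_pos_of_mul_pos h1).mpr hu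

/-- Off the branch, the row of the inverse at the foot of a branch is proportional to the row at
the point of attachment. -/
lemma inv_apply (h : M.IsBranch s u v) (hM : M.PosDef) {z : n} (hz : z ∉ s ∨ z = v) :
    M⁻¹ v z = M⁻¹ v u / M⁻¹ u u * ((if z = v then 1 else 0) + M⁻¹ u z) := by
  have hu := hM.inv.diag_pos (i := u)
  have h1 := h.mul_eq_mul hM (y := fun i => M⁻¹ i z) (y' := fun i => M⁻¹ i u)
    (t := if z = v then 1 else 0) (t' := 0)
    (fun w hw => by
      rw [mulVec_inv hM]
      rcases hz with hz | rfl
      · rw [if_neg (fun e : w = z => hz (e ▸ hw)),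
          if_neg (fun e : z = v => hz (e ▸ h.mem)), ite_self]
      · rw [if_pos rfl])
    (fun w hw => by
      rw [mulVec_inv hM, if_neg (fun e : w = u => h.notMem (e ▸ hw)), ite_self])
  rw [zero_add] at h1
  field_simp
  linarith

end IsBranch

/-- The perturbation has rank at most two, so the matrix determinant lemma leaves a two-by-two
determinant. -/
lemma det_add_vecMulVec_add_vecMulVec (hM : IsUnit M.det) (d w : n → ℝ) :
    (M + vecMulVec d w + vecMulVec w d).det = M.det *
      ((1 + w ⬝ᵥ (M⁻¹ *ᵥ d)) * (1 + d ⬝ᵥ (M⁻¹ *ᵥ w)) -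
        (w ⬝ᵥ (M⁻¹ *ᵥ w)) * (d ⬝ᵥ (M⁻¹ *ᵥ d))) := by
  have h1 : M + vecMulVec d w + vecMulVec w d =
      M + (of ![d, w])ᵀ * of ![w, d] := by
    ext i j
    simp [mul_apply, vecMulVec_apply, add_assoc]
  have h2 : ∀ i j : Fin 2, (of ![w, d] * M⁻¹ * (of ![d, w])ᵀ) i j =
      (![w, d] i) ⬝ᵥ (M⁻¹ *ᵥ (![d, w] j)) := by
    intro i j
    rw [dotProduct_mulVec]
    rfl
  rw [h1, det_add_mul _ _ hM, det_fin_two]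
  simp only [add_apply, h2]
  simp

open Classical in
/-- The effect on the determinant of exchanging the branches with feet `A`, attached to `u`, and
the branches with feet `B`, attached to `p`. -/
lemma det_exchange_branches (hM : M.PosDef) {u p : n} {A B : Finset n} (hAB : Disjoint A B)
    {f : n → ℝ}
    (hA : ∀ v ∈ A, ∀ z, z = u ∨ z = p ∨ z ∈ A ∨ z ∈ B →
      M⁻¹ v z = f v * ((if z = v then 1 else 0) + M⁻¹ u z))
    (hB : ∀ v ∈ B, ∀ z, z = u ∨ z = p ∨ z ∈ A ∨ z ∈ B →
      M⁻¹ v z = f v * ((if z = v then 1 else 0) + M⁻¹ p z))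
    (hu : u ∉ A ∧ u ∉ B) (hp : p ∉ A ∧ p ∉ B) {d w : n → ℝ}
    (hd : d = Pi.single u 1 - Pi.single p 1)
    (hw : w = fun z => (if z ∈ A then 1 else 0) - (if z ∈ B then 1 else 0)) :
    (M + vecMulVec d w + vecMulVec w d).det = M.det *
      (1 + (∑ v ∈ A, f v - ∑ v ∈ B, f v) * (M⁻¹ u u - M⁻¹ p p) -
        (∑ v ∈ A, f v - ∑ v ∈ B, f v) ^ 2 * (M⁻¹ u u * M⁻¹ p p - M⁻¹ u p ^ 2)) := by
  have hsymm : ∀ i j, M⁻¹ i j = M⁻¹ j i := fun i j => by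
    simpa using (hM.inv.isHermitian.apply i j).symm
  have hdw : ∀ g : n → ℝ, d ⬝ᵥ g = g u - g p := by
    intro g
    rw [hd, sub_dotProduct, single_dotProduct, single_dotProduct, one_mul, one_mul]
  have hww : ∀ g : n → ℝ, w ⬝ᵥ g = ∑ v ∈ A, g v - ∑ v ∈ B, g v := by
    intro g
    rw [hw]
    simp only [dotProduct, sub_mul, sum_sub_distrib, ite_mul, one_mul, zero_mul, sum_ite_mem,
      univ_inter]
  have hgw : ∀ i, (M⁻¹ *ᵥ w) i = ∑ v ∈ A, M⁻¹ i v - ∑ v ∈ B, M⁻¹ i v := by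
    intro i
    rw [mulVec, dotProduct_comm, hww]
  set a := ∑ v ∈ A, f v with ha
  set b := ∑ v ∈ B, f v with hb
  have hA1 : ∀ z, z = u ∨ z = p → ∑ v ∈ A, M⁻¹ z v = a * M⁻¹ u z := by
    intro z hz
    rw [ha, sum_mul]
    refine sum_congr rfl fun v hv => ?_
    rw [hsymm, hA v hv z (by tauto), if_neg, zero_add]
    rintro rfl
    rcases hz with rfl | rfl <;> tauto
  have hB1 : ∀ z, z = u ∨ z = p → ∑ v ∈ B, M⁻¹ z v = b * M⁻¹ p z := by
    intro z hz
    rw [hb, sum_mul]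
    refine sum_congr rfl fun v hv => ?_
    rw [hsymm, hB v hv z (by tauto), if_neg, zero_add]
    rintro rfl
    rcases hz with rfl | rfl <;> tauto
  have hgu : (M⁻¹ *ᵥ w) u = a * M⁻¹ u u - b * M⁻¹ u p := by
    rw [hgw, hA1 u (Or.inl rfl), hB1 u (Or.inl rfl), hsymm p u]
  have hgp : (M⁻¹ *ᵥ w) p = a * M⁻¹ u p - b * M⁻¹ p p := by
    rw [hgw, hA1 p (Or.inr rfl), hB1 p (Or.inr rfl)]
  -- Pairing the row relation at `v` with `w` gives `f v * (w v + (M⁻¹ *ᵥ w) u)`, where `w v = 1` on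
  -- `A`; on `B` below, `w v = -1`.
  have hgA : ∀ v ∈ A, (M⁻¹ *ᵥ w) v = f v * (1 + (a * M⁻¹ u u - b * M⁻¹ u p)) := by
    intro v hv
    have hvB : v ∉ B := Finset.disjoint_left.mp hAB hv
    rw [hgw, ← hgu, hgw,
      sum_congr rfl fun z hz => hA v hv z (Or.inr (Or.inr (Or.inl hz))),
      sum_congr rfl fun z hz => hA v hv z (Or.inr (Or.inr (Or.inr hz))),
      ← mul_sum, ← mul_sum, sum_add_distrib, sum_add_distrib, sum_ite_eq' A, sum_ite_eq' B,
      if_pos hv, if_neg hvB]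
    ring
  have hgB : ∀ v ∈ B, (M⁻¹ *ᵥ w) v = f v * (-1 + (a * M⁻¹ u p - b * M⁻¹ p p)) := by
    intro v hv
    have hvA : v ∉ A := Finset.disjoint_right.mp hAB hv
    rw [hgw, ← hgp, hgw,
      sum_congr rfl fun z hz => hB v hv z (Or.inr (Or.inr (Or.inl hz))),
      sum_congr rfl fun z hz => hB v hv z (Or.inr (Or.inr (Or.inr hz))),
      ← mul_sum, ← mul_sum, sum_add_distrib, sum_add_distrib, sum_ite_eq' A, sum_ite_eq' B,
      if_pos hv, if_neg hvA]
    ring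
  have hwgw : w ⬝ᵥ (M⁻¹ *ᵥ w) = a * (1 + (a * M⁻¹ u u - b * M⁻¹ u p)) -
      b * (-1 + (a * M⁻¹ u p - b * M⁻¹ p p)) := by
    rw [hww, sum_congr rfl hgA, sum_congr rfl hgB, ← sum_mul, ← sum_mul]
  have hdgd : d ⬝ᵥ (M⁻¹ *ᵥ d) = M⁻¹ u u + M⁻¹ p p - 2 * M⁻¹ u p := by
    rw [hdw, mulVec, mulVec, dotProduct_comm, hdw, dotProduct_comm, hdw, hsymm p u]
    ring
  have hwgd : w ⬝ᵥ (M⁻¹ *ᵥ d) = d ⬝ᵥ (M⁻¹ *ᵥ w) := by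
    have : (M⁻¹)ᵀ = M⁻¹ := by ext i j; exact hsymm j i
    rw [dotProduct_mulVec, ← mulVec_transpose, this, dotProduct_comm]
  rw [det_add_vecMulVec_add_vecMulVec ((isUnit_iff_isUnit_det _).mp hM.isUnit), hwgd, hwgw, hdgd,
    hdw, hgu, hgp]
  ring

-- A principal two-by-two minor is positive. It is the source of strictness in the exchange
-- argument.
omit [Fintype n] [DecidableEq n] in
lemma PosDef.apply_sq_lt {G : Matrix n n ℝ} (hG : G.PosDef) {u p : n} (hup : u ≠ p) :
    G u p ^ 2 < G u u * G p p := by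
  have h := (hG.submatrix (e := ![u, p]) (by
    intro i j hij
    fin_cases i <;> fin_cases j <;> simp_all [eq_comm])).det_pos
  have hsymm : G p u = G u p := by simpa using (hG.isHermitian.apply p u).symm
  rw [det_fin_two] at h
  simp only [submatrix_apply, cons_val_zero, cons_val_one, hsymm] at h
  nlinarith

end Matrix

/-! ### Exchanging branches of a tree. -/

open Finset Matrix Classical in
lemma degreeSequence_sum {V : Type*} [Fintype V] (G : SimpleGraph V) :
    (degreeSequence G).sum = 2 * #G.edgeFinset := by
  rw [← G.sum_degrees_eq_twice_card_edges]
  rfl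

namespace SimpleGraph
open Finset Matrix

variable {V : Type*} {T : SimpleGraph V} {u p : V} {A B : Finset V}

/-- The degrees fix the number of edges, so after an exchange only connectedness needs checking. -/
lemma IsTree.of_connected_of_degreeSequence_eq [Fintype V] {S : SimpleGraph V} (hT : T.IsTree)
    (hS : S.Connected) (h : degreeSequence S = degreeSequence T) : S.IsTree := by
  classical
  rw [isTree_iff_connected_and_card]
  refine ⟨hS, ?_⟩
  have h1 := (isTree_iff_connected_and_card.mp hT).2
  have h2 := congrArg Multiset.sum h
  rw [degreeSequence_sum, degreeSequence_sum] at h2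
  simp only [Nat.card_eq_fintype_card, ← edgeFinset_card] at h1 ⊢
  omega

/-- The graph in which the neighbours `A` of `u` and the neighbours `B` of `p` are exchanged. -/
def exchange (T : SimpleGraph V) (u p : V) (A B : Finset V) : SimpleGraph V :=
  T \ fromRel (fun y z => y = u ∧ z ∈ A ∨ y = p ∧ z ∈ B) ⊔
    fromRel (fun y z => y = p ∧ z ∈ A ∨ y = u ∧ z ∈ B)

lemma exchange_adj {y z : V} : (T.exchange u p A B).Adj y z ↔
    T.Adj y z ∧ ¬ (y = u ∧ z ∈ A ∨ y = p ∧ z ∈ B) ∧ ¬ (z = u ∧ y ∈ A ∨ z = p ∧ y ∈ B) ∨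
      y ≠ z ∧ ((y = p ∧ z ∈ A ∨ y = u ∧ z ∈ B) ∨ (z = p ∧ y ∈ A ∨ z = u ∧ y ∈ B)) := by
  simp only [exchange, sup_adj, sdiff_adj, fromRel_adj]
  have := T.ne_of_adj (a := y) (b := z)
  tauto

/-- The vertices `A` are neighbours of `u` and the vertices `B` are neighbours of `p`, none of them
on the path between `u` and `p`. -/
structure IsExchangeable (T : SimpleGraph V) (u p : V) (A B : Finset V) : Prop where
  ne : u ≠ p
  adj_left : ∀ v ∈ A, T.Adj u v
  adj_right : ∀ v ∈ B, T.Adj p v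
  dist_left : ∀ v ∈ A, T.dist v p = T.dist u p + 1
  dist_right : ∀ v ∈ B, T.dist v u = T.dist p u + 1

namespace IsExchangeable

lemma symm (h : T.IsExchangeable u p A B) : T.IsExchangeable p u B A :=
  ⟨h.ne.symm, h.adj_right, h.adj_left, h.dist_right, h.dist_left⟩

lemma left_notMem (h : T.IsExchangeable u p A B) : u ∉ A ∧ u ∉ B := by
  refine ⟨fun hu => (h.adj_left u hu).ne rfl, fun hu => ?_⟩
  have := h.dist_right u hu
  rw [dist_self] at this
  omega

lemma not_adj_left (h : T.IsExchangeable u p A B) (hT : T.Connected) {v : V} (hv : v ∈ A) :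
    ¬ T.Adj p v := by
  intro hp
  have h1 := h.dist_left v hv
  rw [dist_eq_one_iff_adj.mpr hp.symm] at h1
  exact h.ne ((hT.dist_eq_zero_iff).mp (by omega))

lemma disjoint (h : T.IsExchangeable u p A B) (hT : T.Connected) : Disjoint A B :=
  Finset.disjoint_left.mpr fun v hA hB => h.not_adj_left hT hA (h.adj_right v hB)

lemma _root_.SimpleGraph.exchange_adj_of_notMem {y z : V} (hyz : T.Adj y z)
    (hy : y ∉ A ∧ y ∉ B) (hz : z ∉ A ∧ z ∉ B) : (T.exchange u p A B).Adj y z := by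
  rw [exchange_adj]
  tauto

lemma reachable_exchange (h : T.IsExchangeable u p A B) (hT : T.Connected) :
    (T.exchange u p A B).Reachable u p := by
  classical
  -- The inequality says that `y` lies on the path from `u` to `p`. That path avoids `A` and `B`, so
  -- its edges survive the exchange.
  suffices hs : ∀ (k : ℕ) (y : V), T.dist y p = k → T.dist y u + k ≤ T.dist u p →
      (T.exchange u p A B).Reachable y p from
    hs _ u rfl (by rw [dist_self, zero_add])
  have hoff : ∀ y, T.dist y u + T.dist y p ≤ T.dist u p → y ∉ A ∧ y ∉ B := by
    intro y hy
    refine ⟨fun hA => ?_, fun hB => ?_⟩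
    · have := h.dist_left y hA
      omega
    · have := h.dist_right y hB
      rw [dist_comm (u := p)] at this
      omega
  intro k
  induction k with
  | zero =>
    intro y hy _
    rw [(hT.dist_eq_zero_iff).mp hy]
  | succ k ih =>
    intro y hy hle
    have hne : y ≠ p := by
      rintro rfl
      rw [dist_self] at hy
      omega
    obtain ⟨z, hyz, hz⟩ := hT.exists_adj_dist_succ hne
    have h1 : T.dist z u ≤ T.dist y u + 1 := by
      have := hT.dist_triangle (u := z) (v := y) (w := u)
      rw [dist_eq_one_iff_adj.mpr hyz.symm] at this
      omega
    refine (exchange_adj_of_notMem hyz (hoff y ?_) (hoff z ?_)).reachable.trans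
      (ih z ?_ ?_) <;> omega

/-- The ends of a removed edge stay connected by a detour along the surviving path between `u` and
`p`. -/
lemma connected_exchange (h : T.IsExchangeable u p A B) (hT : T.Connected) :
    (T.exchange u p A B).Connected := by
  have hup := h.reachable_exchange hT
  have hadj : ∀ y z, T.Adj y z → (T.exchange u p A B).Reachable y z := by
    have hA : ∀ v ∈ A, (T.exchange u p A B).Reachable u v := by
      intro v hv
      refine hup.trans (Adj.reachable ?_)
      have : p ≠ v := by rintro rfl; exact h.symm.left_notMem.2 hv
      rw [exchange_adj]
      tauto
    have hB : ∀ v ∈ B, (T.exchange u p A B).Reachable p v := by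
      intro v hv
      refine hup.symm.trans (Adj.reachable ?_)
      have : u ≠ v := by rintro rfl; exact h.left_notMem.2 hv
      rw [exchange_adj]
      tauto
    intro y z hyz
    by_cases h1 : y = u ∧ z ∈ A
    · rw [h1.1]; exact hA z h1.2
    by_cases h2 : y = p ∧ z ∈ B
    · rw [h2.1]; exact hB z h2.2
    by_cases h3 : z = u ∧ y ∈ A
    · rw [h3.1]; exact (hA y h3.2).symm
    by_cases h4 : z = p ∧ y ∈ B
    · rw [h4.1]; exact (hB y h4.2).symm
    exact (exchange_adj.mpr (Or.inl ⟨hyz, not_or.mpr ⟨h1, h2⟩, not_or.mpr ⟨h3, h4⟩⟩)).reachable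
  have hne := hT.nonempty
  refine ⟨fun y z => ?_⟩
  obtain ⟨w⟩ := hT.preconnected y z
  induction w with
  | nil => rfl
  | cons hadj' _ ih => exact (hadj _ _ hadj').trans ih

variable [Fintype V]

omit [Fintype V] in
open Classical in
lemma adjMatrix_exchange (h : T.IsExchangeable u p A B) (hT : T.Connected) {d w : V → ℝ}
    (hd : d = Pi.single u 1 - Pi.single p 1)
    (hw : w = fun z => (if z ∈ A then 1 else 0) - (if z ∈ B then 1 else 0)) :
    (T.exchange u p A B).adjMatrix ℝ = T.adjMatrix ℝ - vecMulVec d w - vecMulVec w d := by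
  have h1 := h.left_notMem
  have h2 := h.symm.left_notMem
  have h3 : ∀ v ∈ A, ¬ T.Adj p v := fun v hv => h.not_adj_left hT hv
  have h4 : ∀ v ∈ B, ¬ T.Adj u v := fun v hv => h.symm.not_adj_left hT hv
  have h5 := h.adj_left
  have h6 := h.adj_right
  have h7 := h.ne
  have h8 : ∀ v ∈ A, v ∉ B := fun v hv => Finset.disjoint_left.mp (h.disjoint hT) hv
  ext y z
  have h9 := T.adj_comm y z
  have h10 := T.irrefl (v := y)
  rw [Matrix.sub_apply, Matrix.sub_apply, adjMatrix_apply, adjMatrix_apply, if_congr exchange_adj rfl rfl]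
  clear h hT
  simp only [vecMulVec_apply, hd, hw, Pi.sub_apply, Pi.single_apply]
  clear hd hw
  -- Entries change only where an index is `u` or `p`, which leaves finitely many cases.
  by_cases hyu : y = u
  · subst hyu
    grind
  by_cases hyp : y = p
  · subst hyp
    grind
  by_cases hzu : z = u
  · subst hzu
    grind
  by_cases hzp : z = p
  · subst hzp
    grind
  grind

open Classical in
lemma degree_exchange (h : T.IsExchangeable u p A B) (hT : T.Connected) (y : V) :
    ((T.exchange u p A B).degree y : ℤ) =
      T.degree y + (if y = u then (#B : ℤ) - #A else 0) - (if y = p then (#B : ℤ) - #A else 0) := by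
  have h0 : ∀ S : SimpleGraph V, ((S.degree y : ℕ) : ℝ) = (S.adjMatrix ℝ *ᵥ fun _ => 1) y := by
    intro S
    exact ((S.adjMatrix_mulVec_const_apply (a := (1 : ℝ)) (v := y)).trans (mul_one _)).symm
  have h1 : (((T.exchange u p A B).degree y : ℕ) : ℝ) =
      T.degree y + (if y = u then (#B : ℝ) - #A else 0) -
        (if y = p then (#B : ℝ) - #A else 0) := by
    rw [h0, h0, h.adjMatrix_exchange hT rfl rfl, sub_mulVec, sub_mulVec, Pi.sub_apply,
      Pi.sub_apply, vecMulVec_mulVec, vecMulVec_mulVec]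
    simp only [dotProduct, mul_one, Pi.smul_apply, Pi.sub_apply, Pi.single_apply,
      sum_sub_distrib, sum_ite_mem, univ_inter, sum_const, nsmul_eq_mul, sum_ite_eq', mem_univ,
      if_true, sub_self, op_smul_eq_smul, smul_eq_mul, zero_mul]
    split_ifs <;> ring
  exact_mod_cast h1

-- In the first case of `hc` no degree changes; in the second, `u` and `p` swap degrees.
open Classical in
lemma degreeSequence_exchange (h : T.IsExchangeable u p A B) (hT : T.Connected)
    (hc : #A = #B ∨ #B + T.degree u = #A + T.degree p) :
    degreeSequence (T.exchange u p A B) = degreeSequence T := by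
  have h1 := h.degree_exchange hT
  have hne := h.ne
  unfold degreeSequence
  rcases hc with hc | hc
  · refine Multiset.map_congr rfl fun y _ => ?_
    have := h1 y
    simp only [hc, sub_self, ite_self] at this
    omega
  · rw [← Multiset.map_univ_val_equiv (Equiv.swap u p), Multiset.map_map,
      Multiset.map_univ_val_equiv]
    refine Multiset.map_congr rfl fun y _ => ?_
    rw [Function.comp_apply]
    by_cases hyu : y = u
    · subst hyu
      have := h1 p
      rw [if_pos rfl, if_neg hne.symm] at this
      rw [Equiv.swap_apply_left]
      omega
    by_cases hyp : y = p
    · subst hyp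
      have := h1 u
      rw [if_pos rfl, if_neg hne] at this
      rw [Equiv.swap_apply_right]
      omega
    have := h1 y
    rw [if_neg hyu, if_neg hyp] at this
    rw [Equiv.swap_apply_of_ne_of_ne hyu hyp]
    omega

end IsExchangeable
end SimpleGraph

/-! ### The Green matrix of a minimizer. -/

namespace SimpleGraph
open Finset Matrix

variable {V : Type*} [Fintype V] {T : SimpleGraph V} {u p : V} {A B : Finset V} {x : ℝ}

open Classical in
/-- The inverse of `x - A` for the adjacency matrix `A` of `T`. -/
noncomputable def green (T : SimpleGraph V) (x : ℝ) : Matrix V V ℝ :=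
  (Matrix.scalar V x - T.adjMatrix ℝ)⁻¹

open Classical in
lemma eval_graphCharpoly (T : SimpleGraph V) (x : ℝ) :
    (graphCharpoly T).eval x = (Matrix.scalar V x - T.adjMatrix ℝ).det :=
  Matrix.eval_charpoly _ _

open Classical in
lemma IsTree.isBranch (hT : T.IsTree) {u v : V} (huv : T.Adj u v) (x : ℝ) :
    (Matrix.scalar V x - T.adjMatrix ℝ).IsBranch {w | T.dist v w < T.dist u w} u v where
  mem := by
    rw [Set.mem_ofPred_eq, dist_self]
    exact hT.connected.pos_dist_of_ne huv.ne
  notMem := by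
    rw [Set.mem_ofPred_eq, dist_self]
    exact Nat.not_lt_zero _
  entry := by
    rw [Matrix.sub_apply, Matrix.scalar_apply, Matrix.diagonal_apply_ne _ huv.ne', adjMatrix_apply,
      if_pos huv.symm, zero_sub]
  entry_eq_zero w hw z hz h := by
    have hwz : w ≠ z := by
      rintro rfl
      exact hz hw
    rw [Matrix.sub_apply, Matrix.scalar_apply, Matrix.diagonal_apply_ne _ hwz, adjMatrix_apply,
      if_neg fun hadj => h (hT.eq_of_adj_of_side huv hadj hw hz), sub_zero]

open Classical in
/-- `T` minimizes the characteristic polynomial at `x` among the trees with its degree sequence,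
and `x` exceeds the eigenvalues of `T`. -/
structure IsCharpolyMinimizer (T : SimpleGraph V) (x : ℝ) : Prop where
  isTree : T.IsTree
  posDef : (Matrix.scalar V x - T.adjMatrix ℝ).PosDef
  le : ∀ S : SimpleGraph V, S.IsTree → degreeSequence S = degreeSequence T →
    (graphCharpoly T).eval x ≤ (graphCharpoly S).eval x

open Classical in
lemma IsExchangeable.eval_graphCharpoly_exchange (h : T.IsExchangeable u p A B) (hT : T.IsTree)
    (hM : (Matrix.scalar V x - T.adjMatrix ℝ).PosDef) {a b : ℝ}
    (ha : a = ∑ v ∈ A, T.green x v u / T.green x u u)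
    (hb : b = ∑ v ∈ B, T.green x v p / T.green x p p) :
    (graphCharpoly (T.exchange u p A B)).eval x = (graphCharpoly T).eval x *
      (1 + (a - b) * (T.green x u u - T.green x p p) -
        (a - b) ^ 2 * (T.green x u u * T.green x p p - T.green x u p ^ 2)) := by
  have hAB := h.disjoint hT.connected
  -- The proportionality of rows holds only off the branch at `v` or at `v` itself, so the
  -- attachment points and the other feet must lie outside that branch.
  have side : ∀ {u p : V} {A B : Finset V}, T.IsExchangeable u p A B → ∀ v ∈ A, ∀ z,
      z = u ∨ z = p ∨ z ∈ A ∨ z ∈ B → z ∉ {w | T.dist v w < T.dist u w} ∨ z = v := by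
    intro u p A B h v hv z hz
    rw [or_iff_not_imp_right]
    intro hzv
    rw [Set.mem_ofPred_eq]
    have hpos := hT.connected.pos_dist_of_ne (Ne.symm hzv)
    have huv := h.adj_left v hv
    have hvp := h.dist_left v hv
    rcases hz with rfl | rfl | hz | hz
    · rw [dist_self]
      omega
    · omega
    · rw [dist_eq_one_iff_adj.mpr (h.adj_left z hz)]
      omega
    · intro hlt
      exact hzv (hT.eq_of_adj_of_side huv (h.adj_right z hz).symm hlt (by omega)).1
  have key := det_exchange_branches hM hAB
    (f := fun v => if v ∈ A then T.green x v u / T.green x u u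
      else T.green x v p / T.green x p p)
    (fun v hv z hz => by
      rw [if_pos hv]
      exact (hT.isBranch (h.adj_left v hv) x).inv_apply hM (side h v hv z hz))
    (fun v hv z hz => by
      rw [if_neg (Finset.disjoint_right.mp hAB hv)]
      exact (hT.isBranch (h.adj_right v hv) x).inv_apply hM (side h.symm v hv z (by tauto)))
    h.left_notMem h.symm.left_notMem.symm rfl rfl
  rw [sum_congr rfl fun v hv => if_pos hv, ← ha, sum_congr rfl fun v hv =>
    if_neg (Finset.disjoint_right.mp hAB hv), ← hb] at key
  rw [eval_graphCharpoly, eval_graphCharpoly, h.adjMatrix_exchange hT.connected rfl rfl, ← sub_add,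
    ← sub_add]
  exact key

namespace IsCharpolyMinimizer

variable (hm : T.IsCharpolyMinimizer x)
include hm

-- Otherwise `a - b < 0 ≤ g u u - g p p`: neither correction to the factor is positive and the
-- quadratic one is negative, so the exchanged tree has a smaller value.
open Classical in
lemma sum_le_sum (h : T.IsExchangeable u p A B) (hc : #A = #B ∨ #B + T.degree u = #A + T.degree p)
    (hup : T.green x p p ≤ T.green x u u) :
    ∑ v ∈ B, T.green x v p / T.green x p p ≤ ∑ v ∈ A, T.green x v u / T.green x u u := by
  have h1 := hm.le _ (hm.isTree.of_connected_of_degreeSequence_eq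
    (h.connected_exchange hm.isTree.connected)
    (h.degreeSequence_exchange hm.isTree.connected hc))
    (h.degreeSequence_exchange hm.isTree.connected hc)
  rw [h.eval_graphCharpoly_exchange hm.isTree hm.posDef rfl rfl, eval_graphCharpoly] at h1
  have h2 := hm.posDef.det_pos
  have h3 := hm.posDef.inv.apply_sq_lt h.ne
  change T.green x u p ^ 2 < T.green x u u * T.green x p p at h3
  by_contra! hlt
  have h4 := mul_nonneg (sub_nonneg.mpr hlt.le) (sub_nonneg.mpr hup)
  have h5 := mul_pos (pow_pos (sub_pos.mpr hlt) 2) (sub_pos.mpr h3)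
  have h6 := mul_pos h2 (add_pos_of_nonneg_of_pos h4 h5)
  linarith

open Classical in
lemma green_self_pos (u : V) : 0 < T.green x u u := hm.posDef.inv.diag_pos

open Classical in
lemma green_pos_of_adj {v : V} (h : T.Adj u v) : 0 < T.green x v u :=
  (hm.isTree.isBranch h x).inv_pos hm.posDef

/-- With `f = g v u / g u u`, the row relation and symmetry give `g v v = f * (1 + f * g u u)`. This
increases in both `f` and `g u u`, so the order of diagonal entries passes to neighbours. -/
lemma green_self_eq {v : V} (h : T.Adj u v) : T.green x v v =
    T.green x v u / T.green x u u + (T.green x v u / T.green x u u) ^ 2 * T.green x u u := by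
  classical
  have h1 := (hm.isTree.isBranch h x).inv_apply hm.posDef (Or.inr rfl)
  have hsymm : T.green x u v = T.green x v u := by
    exact (star_trivial _).symm.trans (hm.posDef.inv.isHermitian.apply v u)
  change T.green x v v = T.green x v u / T.green x u u * ((if v = v then 1 else 0) + T.green x u v)
    at h1
  rw [h1, if_pos rfl, hsymm]
  have := (hm.green_self_pos u).ne'
  field_simp

lemma branch_le_branch {v q : V} (hne : u ≠ p) (hup : T.green x p p ≤ T.green x u u)
    (huv : T.Adj u v) (hpq : T.Adj p q) (hv : T.dist v p = T.dist u p + 1)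
    (hq : T.dist q u = T.dist p u + 1) :
    T.green x q p / T.green x p p ≤ T.green x v u / T.green x u u := by
  have h : T.IsExchangeable u p {v} {q} :=
    ⟨hne, by simpa using huv, by simpa using hpq, by simpa using hv, by simpa using hq⟩
  simpa using hm.sum_le_sum h (Or.inl (by simp)) hup

/-- If the diagonal entry of the Green matrix at `u` is at least that at `p`, this carries over to
the neighbours of `u` and `p` outside the path between them. -/
lemma green_le_green {v q : V} (hne : u ≠ p) (hup : T.green x p p ≤ T.green x u u)
    (huv : T.Adj u v) (hpq : T.Adj p q) (hv : T.dist v p = T.dist u p + 1)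
    (hq : T.dist q u = T.dist p u + 1) : T.green x q q ≤ T.green x v v := by
  have h1 := hm.branch_le_branch hne hup huv hpq hv hq
  rw [hm.green_self_eq huv, hm.green_self_eq hpq]
  have h2 := div_pos (hm.green_pos_of_adj hpq) (hm.green_self_pos p)
  have h3 := hm.green_self_pos p
  gcongr

lemma green_lt_green {v q : V} (hup : T.green x p p < T.green x u u)
    (huv : T.Adj u v) (hpq : T.Adj p q) (hv : T.dist v p = T.dist u p + 1)
    (hq : T.dist q u = T.dist p u + 1) : T.green x q q < T.green x v v := by
  have hne : u ≠ p := by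
    rintro rfl
    exact lt_irrefl _ hup
  have h1 := hm.branch_le_branch hne hup.le huv hpq hv hq
  rw [hm.green_self_eq huv, hm.green_self_eq hpq]
  have h2 := div_pos (hm.green_pos_of_adj hpq) (hm.green_self_pos p)
  have h3 := hm.green_self_pos p
  exact add_lt_add_of_le_of_lt h1 (mul_lt_mul' (pow_le_pow_left₀ h2.le h1 2) hup h3.le
    (pow_pos (h2.trans_le h1) 2))

-- If `p` had larger degree, moving its surplus branches to `u` (with `A = ∅`) would swap the two
-- degrees, and a positive sum would have to be at most zero.
open Classical in
lemma degree_le_degree (hne : u ≠ p) (hup : T.green x p p ≤ T.green x u u) :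
    T.degree p ≤ T.degree u := by
  by_contra! hlt
  have hT := hm.isTree
  have hu : 0 < T.degree u := by
    obtain ⟨v, hv, _⟩ := hT.connected.exists_adj_dist_succ hne
    exact (T.degree_pos_iff_exists_adj u).mpr ⟨v, hv⟩
  obtain ⟨w, hw, hwd⟩ := hT.connected.exists_adj_dist_succ hne.symm
  -- The neighbour `w` of `p` towards `u` cannot be moved; as `u` has positive degree, enough others
  -- remain.
  have hcard : T.degree p - T.degree u ≤ #((T.neighborFinset p).erase w) := by
    rw [card_erase_of_mem (by simpa using hw), card_neighborFinset_eq_degree]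
    omega
  obtain ⟨B, hB, hBc⟩ := exists_subset_card_eq hcard
  have hBmem : ∀ v ∈ B, T.Adj p v ∧ v ≠ w := by
    intro v hv
    have := hB hv
    rw [mem_erase, mem_neighborFinset] at this
    exact this.symm
  have h : T.IsExchangeable u p ∅ B := by
    refine ⟨hne, by simp, fun v hv => (hBmem v hv).1, by simp, fun v hv => ?_⟩
    refine (hT.dist_left_of_adj (hBmem v hv).1 u).resolve_left fun h => ?_
    exact (hBmem v hv).2 (hT.eq_of_adj_dist_succ (hBmem v hv).1 hw h hwd)
  have h1 := hm.sum_le_sum h (Or.inr (by rw [hBc, card_empty]; omega)) hup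
  rw [sum_empty] at h1
  refine absurd h1 (not_le.mpr (sum_pos (fun v hv => ?_) ?_))
  · exact div_pos (hm.green_pos_of_adj (hBmem v hv).1) (hm.green_self_pos p)
  · rw [← card_pos]
    omega

end IsCharpolyMinimizer
end SimpleGraph

/-! ### Greedy weights decrease from level to level. -/

namespace SimpleGraph
open Finset

variable {V : Type*} [Fintype V] {T : SimpleGraph V} {γ : V → ℝ} {r : V}

open Classical in
/-- A weight on the vertices of a tree that forces the tree to be greedy. -/
structure IsGreedyWeight (T : SimpleGraph V) (γ : V → ℝ) : Prop where
  degree_le : ∀ u p, u ≠ p → γ p ≤ γ u → T.degree p ≤ T.degree u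
  le : ∀ u p v q, u ≠ p → γ p ≤ γ u → T.Adj u v → T.Adj p q → T.dist v p = T.dist u p + 1 →
    T.dist q u = T.dist p u + 1 → γ q ≤ γ v
  lt : ∀ u p v q, γ p < γ u → T.Adj u v → T.Adj p q → T.dist v p = T.dist u p + 1 →
    T.dist q u = T.dist p u + 1 → γ q < γ v

lemma IsCharpolyMinimizer.isGreedyWeight {x : ℝ} (h : T.IsCharpolyMinimizer x) :
    T.IsGreedyWeight (fun v => T.green x v v) where
  degree_le _ _ := h.degree_le_degree
  le _ _ _ _ := h.green_le_green
  lt _ _ _ _ := h.green_lt_green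

omit [Fintype V] in
lemma IsTree.dist_child (hT : T.IsTree) {u v a : V} (huv : T.Adj u v)
    (hv : T.dist v r = T.dist u r + 1) (ha : T.dist a r ≤ T.dist v r) (hne : a ≠ v) :
    T.dist v a = T.dist u a + 1 := by
  refine (hT.dist_left_of_adj huv a).resolve_left fun h => hne ?_
  have h1 := hT.dist_eq_of_adj_of_lt_of_lt huv (p := a) (r := r) (by omega) (by omega)
  rw [dist_comm (u := r), dist_comm (u := r)] at h1
  exact ((hT.connected.dist_eq_zero_iff).mp (by omega)).symm

namespace IsGreedyWeight

variable (hγ : T.IsGreedyWeight γ) (hT : T.IsTree) (hr : ∀ v, γ v ≤ γ r)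
include hγ hT hr

/-- Suppose a descendant `u` of `p` were heavier. As `p` has a parent `q` and a neighbour towards
`u`, the degree of `u` is at least two, so `u` has a child `v`. The strict transfer makes `v`
heavier than its ancestor `q`, contradicting induction on the depth of `p`. -/
lemma le_of_geodesic {u p : V} (h : T.dist u r = T.dist u p + T.dist p r) : γ u ≤ γ p := by
  classical
  induction hk : T.dist p r generalizing u p with
  | zero =>
    rw [(hT.connected.dist_eq_zero_iff).mp hk]
    exact hr u
  | succ k ih =>
    by_contra! hlt
    have hne : u ≠ p := by
      rintro rfl
      exact lt_irrefl _ hlt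
    have hpr : p ≠ r := by
      rintro rfl
      rw [dist_self] at hk
      omega
    have hur : u ≠ r := by
      rintro rfl
      rw [dist_self] at h
      omega
    obtain ⟨q, hpq, hq⟩ := hT.connected.exists_adj_dist_succ hpr
    obtain ⟨s, hps, hs⟩ := hT.connected.exists_adj_dist_succ hne.symm
    obtain ⟨w, huw, hw⟩ := hT.connected.exists_adj_dist_succ hur
    have hqu : T.dist q u = T.dist p u + 1 := by
      have h1 := hT.connected.dist_triangle (u := u) (v := q) (w := r)
      rw [dist_comm (u := u), dist_comm (u := u) (v := q)] at h1
      rw [dist_comm (u := u) (v := p), dist_comm (u := u)] at h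
      have := hT.dist_left_of_adj hpq u
      omega
    have hqs : q ≠ s := by
      rintro rfl
      omega
    have hdeg : 1 < T.degree u := by
      refine lt_of_lt_of_le ?_ (hγ.degree_le u p hne hlt.le)
      rw [← card_neighborFinset_eq_degree, one_lt_card]
      exact ⟨q, by simpa using hpq, s, by simpa using hps, hqs⟩
    rw [← card_neighborFinset_eq_degree] at hdeg
    obtain ⟨v, hv, hvw⟩ := exists_mem_ne hdeg w
    rw [mem_neighborFinset] at hv
    have hvr : T.dist v r = T.dist u r + 1 :=
      (hT.dist_left_of_adj hv r).resolve_left fun h' => hvw (hT.eq_of_adj_dist_succ hv huw h' hw)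
    have hvp : T.dist v p = T.dist u p + 1 := by
      have h1 := hT.connected.dist_triangle (u := v) (v := p) (w := r)
      have := hT.dist_left_of_adj hv p
      omega
    have hvq : T.dist v r = T.dist v q + T.dist q r := by
      have h1 := hT.connected.dist_triangle (u := v) (v := q) (w := r)
      have h2 := hT.connected.dist_triangle (u := v) (v := p) (w := q)
      rw [dist_eq_one_iff_adj.mpr hpq] at h2
      omega
    exact absurd (ih hvq (by omega)) (not_le.mpr (hγ.lt u p v q hlt hv hpq hvp hqu))

-- Serves parents on equal or consecutive levels. Excluding `p = v` ensures that neither edge lies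
-- on the path from `u` to `p`.
omit hr in
lemma le_of_parents {u p v q : V} (hne : u ≠ p) (hup : γ p ≤ γ u) (huv : T.Adj u v)
    (hpq : T.Adj p q) (hv : T.dist v r = T.dist u r + 1) (hq : T.dist q r = T.dist p r + 1)
    (hl : T.dist u r ≤ T.dist p r) (hpv : p ≠ v) (hl' : T.dist p r ≤ T.dist u r + 1) :
    γ q ≤ γ v := by
  refine hγ.le u p v q hne hup huv hpq (hT.dist_child huv hv (by omega) hpv)
    (hT.dist_child hpq hq (by omega) ?_)
  rintro rfl
  omega

/-- Pass to the parents of `v` and `q`, again on consecutive levels; if `v` is itself the parent of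
`q`, use the comparison with ancestors. -/
lemma le_of_level_succ {v q : V} (h : T.dist q r = T.dist v r + 1) : γ q ≤ γ v := by
  induction hk : T.dist v r generalizing v q with
  | zero =>
    rw [(hT.connected.dist_eq_zero_iff).mp hk]
    exact hr q
  | succ k ih =>
    obtain ⟨p, hqp, hp⟩ := hT.connected.exists_adj_dist_succ (u := q) (r := r) (by
      rintro rfl
      rw [dist_self] at h
      omega)
    obtain ⟨u, hvu, hu⟩ := hT.connected.exists_adj_dist_succ (u := v) (r := r) (by
      rintro rfl
      rw [dist_self] at hk
      omega)
    by_cases hpv : p = v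
    · subst hpv
      apply hγ.le_of_geodesic hT hr
      rw [dist_eq_one_iff_adj.mpr hqp]
      omega
    · have hup := ih (v := u) (q := p) (by omega) (by omega)
      refine hγ.le_of_parents hT (r := r) ?_ hup hvu.symm hqp.symm hu hp (by omega) hpv (by omega)
      rintro rfl
      omega

end IsGreedyWeight
end SimpleGraph

/-! ### Positions in a concatenation of lists. -/

namespace List
variable {α β : Type*}

/-- The number of elements that the first `j` members of `l` contribute to `l.flatMap f`. -/
lemma getElem_flatMap_add (f : α → List β) {l : List α} {j i : ℕ} (hj : j < l.length)
    (hi : i < (f l[j]).length) :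
    (l.flatMap f)[((l.take j).map (fun a => (f a).length)).sum + i]? = some (f l[j])[i] := by
  induction l generalizing j with
  | nil => simp at hj
  | cons a l ih =>
    cases j with
    | zero =>
      simp only [getElem_cons_zero] at hi
      simp [List.getElem?_append_left hi]
    | succ j =>
      simp only [getElem_cons_succ] at hi
      rw [flatMap_cons, take_succ_cons, map_cons, sum_cons, add_assoc,
        getElem?_append_right (by omega), Nat.add_sub_cancel_left]
      simpa using ih (by simpa using hj) hi

lemma sum_map_take_succ (g : α → ℕ) {l : List α} {j : ℕ} (hj : j < l.length) :
    ((l.take (j + 1)).map g).sum = ((l.take j).map g).sum + g l[j] := by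
  rw [take_add_one, getElem?_eq_getElem hj, map_append, sum_append]
  simp only [Option.toList_some, map_cons, map_nil, sum_cons, sum_nil, add_zero]

/-- The interval of positions is the one in `IsGreedyChild`; without repetitions an element
determines its position. -/
lemma getElem_flatMap_mem_iff (f : α → List β) {l : List α} (hn : (l.flatMap f).Nodup) {j k : ℕ}
    (hj : j < l.length) (hk : k < (l.flatMap f).length) :
    (l.flatMap f)[k] ∈ f l[j] ↔ ((l.take j).map (fun a => (f a).length)).sum ≤ k ∧
      k < ((l.take (j + 1)).map (fun a => (f a).length)).sum := by
  rw [sum_map_take_succ _ hj]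
  constructor
  · intro h
    obtain ⟨i, hi, he⟩ := getElem_of_mem h
    have h1 := getElem_flatMap_add f hj hi
    rw [he, ← getElem?_eq_getElem hk] at h1
    have := (getElem?_inj hk hn).mp h1.symm
    omega
  · rintro ⟨h1, h2⟩
    obtain ⟨i, rfl⟩ := Nat.exists_eq_add_of_le h1
    have hi : i < (f l[j]).length := by omega
    have h3 := getElem_flatMap_add f hj hi
    rw [getElem?_eq_getElem hk, Option.some_inj] at h3
    rw [h3]
    exact getElem_mem hi

end List

/-! ### From a greedy weight to a level greedy tree. -/

namespace SimpleGraph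
open Finset

variable {V : Type*} {T : SimpleGraph V} {γ : V → ℝ} {r : V} {c : V → List V}

/-- The vertices at the levels of a rooted tree, if `c` lists the children of each vertex. -/
def levelList (c : V → List V) (r : V) : ℕ → List V
  | 0 => [r]
  | h + 1 => (levelList c r h).flatMap c

section
variable (hT : T.IsTree) (hc : ∀ u v, v ∈ c u ↔ T.Adj u v ∧ T.dist v r = T.dist u r + 1)
include hT hc

lemma mem_levelList {h : ℕ} {v : V} : v ∈ levelList c r h ↔ T.dist v r = h := by
  induction h generalizing v with
  | zero => rw [levelList, List.mem_singleton, hT.connected.dist_eq_zero_iff]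
  | succ h ih =>
    rw [levelList, List.mem_flatMap]
    constructor
    · rintro ⟨u, hu, hv⟩
      rw [((hc u v).mp hv).2, ih.mp hu]
    · intro hv
      obtain ⟨u, hu, hd⟩ := hT.connected.exists_adj_dist_succ (u := v) (r := r) (by
        rintro rfl
        rw [dist_self] at hv
        omega)
      exact ⟨u, ih.mpr (by omega), (hc u v).mpr ⟨hu.symm, hd⟩⟩

lemma nodup_levelList (hn : ∀ u, (c u).Nodup) (h : ℕ) : (levelList c r h).Nodup := by
  induction h with
  | zero => exact List.nodup_singleton r
  | succ h ih =>
    rw [levelList, List.nodup_flatMap]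
    refine ⟨fun u _ => hn u, List.Pairwise.imp_of_mem ?_ ih⟩
    intro u p _ _ hne v hvu hvp
    obtain ⟨h1, h2⟩ := (hc u v).mp hvu
    obtain ⟨h3, h4⟩ := (hc p v).mp hvp
    exact hne (hT.eq_of_adj_dist_succ h1.symm h3.symm h2 h4)

lemma adj_iff_mem_or_mem (u v : V) : T.Adj u v ↔ v ∈ c u ∨ u ∈ c v := by
  rw [hc, hc]
  refine ⟨fun h => ?_, fun h => h.elim (fun h => h.1) fun h => h.1.symm⟩
  exact (hT.dist_left_of_adj h r).elim (fun hd => Or.inr ⟨h.symm, hd⟩) fun hd => Or.inl ⟨h, hd⟩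

variable [Fintype V]

open Classical in
lemma length_children (hn : ∀ u, (c u).Nodup) (u : V) :
    (c u).length = childCount (T.dist u r) (T.degree u) := by
  have h1 : (c u).length = #((T.neighborFinset u).filter fun v => T.dist v r = T.dist u r + 1) := by
    rw [← List.toFinset_card_of_nodup (hn u)]
    congr 1
    ext v
    simp [hc]
  rw [h1, childCount]
  split_ifs with h
  · rw [filter_true_of_mem, card_neighborFinset_eq_degree]
    intro v hv
    rw [mem_neighborFinset] at hv
    have := hT.dist_left_of_adj hv r
    omega
  · obtain ⟨w, huw, hw⟩ := hT.connected.exists_adj_dist_succ (u := u) (r := r) (by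
      rintro rfl
      exact h dist_self)
    rw [← card_neighborFinset_eq_degree, ← card_erase_of_mem (a := w) (by simpa using huw)]
    congr 1
    ext v
    rw [mem_filter, mem_erase, mem_neighborFinset]
    constructor
    · rintro ⟨h1, h2⟩
      refine ⟨?_, h1⟩
      rintro rfl
      omega
    · rintro ⟨h1, h2⟩
      refine ⟨h2, (hT.dist_left_of_adj h2 r).resolve_left fun h3 => h1 ?_⟩
      exact hT.eq_of_adj_dist_succ h2 huw h3 hw

-- Siblings are sorted by choice of `c`; vertices with different parents inherit the order of the
-- parents.
open Classical in
lemma pairwise_levelList (hn : ∀ u, (c u).Nodup) (hγ : T.IsGreedyWeight γ)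
    (hs : ∀ u, (c u).Pairwise (fun a b => γ b ≤ γ a)) (h : ℕ) :
    (levelList c r h).Pairwise (fun a b => γ b ≤ γ a) := by
  induction h with
  | zero => exact List.pairwise_singleton _ r
  | succ h ih =>
    rw [levelList, List.pairwise_flatMap]
    refine ⟨fun u _ => hs u, List.Pairwise.imp_of_mem ?_ (ih.and (nodup_levelList hT hc hn h))⟩
    rintro u p hu hp ⟨hup, hne⟩ v hv q hq
    obtain ⟨h1, h2⟩ := (hc u v).mp hv
    obtain ⟨h3, h4⟩ := (hc p q).mp hq
    rw [mem_levelList hT hc] at hu hp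
    refine hγ.le_of_parents hT hne hup h1 h3 h2 h4 (by omega) ?_ (by omega)
    rintro rfl
    omega

end
end SimpleGraph

namespace SimpleGraph
open Finset

variable {V : Type*} {T : SimpleGraph V} {γ : V → ℝ} {r : V} {c : V → List V}

open Classical in
/-- The degrees at the first `n` levels of a rooted tree. -/
noncomputable def leveledDegrees [Fintype V] (T : SimpleGraph V) (c : V → List V) (r : V) (n : ℕ) :
    List (List ℕ) :=
  (List.range n).map fun h => (levelList c r h).map fun v => T.degree v

section
variable [Fintype V] {n : ℕ}

lemma length_leveledDegrees : (T.leveledDegrees c r n).length = n := by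
  simp [leveledDegrees]

open Classical in
lemma get_leveledDegrees (h : Fin (T.leveledDegrees c r n).length) :
    (T.leveledDegrees c r n).get h = (levelList c r h).map fun v => T.degree v := by
  rw [List.get_eq_getElem]
  simp only [leveledDegrees, List.getElem_map, List.getElem_range]

lemma length_get_leveledDegrees (h : Fin (T.leveledDegrees c r n).length) :
    ((T.leveledDegrees c r n).get h).length = (levelList c r h).length := by
  rw [get_leveledDegrees, List.length_map]

variable (hT : T.IsTree) (hc : ∀ u v, v ∈ c u ↔ T.Adj u v ∧ T.dist v r = T.dist u r + 1)
  (hn : ∀ u, (c u).Nodup)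
include hT hc hn

lemma map_childCount_take (h : Fin (T.leveledDegrees c r n).length) (j : ℕ) :
    (((T.leveledDegrees c r n).get h).take j).map (childCount h) =
      ((levelList c r h).take j).map (fun u => (c u).length) := by
  rw [get_leveledDegrees, ← List.map_take, List.map_map]
  refine List.map_congr_left fun u hu => ?_
  rw [Function.comp_apply, length_children hT hc hn,
    (mem_levelList hT hc).mp (List.mem_of_mem_take hu)]

lemma isLeveledDegreeSequence_leveledDegrees (hγ : T.IsGreedyWeight γ)
    (hs : ∀ u, (c u).Pairwise (fun a b => γ b ≤ γ a))
    (hne : ∀ h < n, levelList c r h ≠ []) (hnil : levelList c r n = []) :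
    IsLeveledDegreeSequence (T.leveledDegrees c r n) where
  level_ne_nil l hl := by
    obtain ⟨h, rfl⟩ := List.get_of_mem hl
    rw [get_leveledDegrees, ne_eq, List.map_eq_nil_iff]
    exact hne h (h.2.trans_eq length_leveledDegrees)
  level_nonincreasing l hl := by
    obtain ⟨h, rfl⟩ := List.get_of_mem hl
    rw [get_leveledDegrees, List.pairwise_map]
    exact ((pairwise_levelList hT hc hn hγ hs h).and (nodup_levelList hT hc hn h)).imp
      fun hab => hγ.degree_le _ _ hab.2 hab.1
  degree_pos h hpos d hd := by
    classical
    rw [get_leveledDegrees, List.mem_map] at hd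
    obtain ⟨v, hv, rfl⟩ := hd
    rw [mem_levelList hT hc] at hv
    obtain ⟨u, hu, _⟩ := hT.connected.exists_adj_dist_succ (u := v) (r := r) (by
      rintro rfl
      rw [dist_self] at hv
      omega)
    exact (T.degree_pos_iff_exists_adj v).mpr ⟨u, hu⟩
  length_next h := by
    have h1 : ((T.leveledDegrees c r n).getD (h + 1) []).length =
        (levelList c r (h + 1)).length := by
      by_cases hlt : (h : ℕ) + 1 < (T.leveledDegrees c r n).length
      · rw [List.getD_eq_getElem _ _ hlt]
        exact length_get_leveledDegrees ⟨h + 1, hlt⟩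
      -- On the last level `getD` returns its default `[]`, matching the empty level `n`.
      · have h2 := h.2
        rw [List.getD_eq_default _ _ (not_lt.mp hlt)]
        have h3 := length_leveledDegrees (T := T) (c := c) (r := r) (n := n)
        rw [show (h : ℕ) + 1 = n by omega, hnil, List.length_nil, List.length_nil]
    have h2 := map_childCount_take hT hc hn h ((T.leveledDegrees c r n).get h).length
    rw [List.take_length, length_get_leveledDegrees, List.take_length] at h2
    rw [h1, h2, levelList, List.length_flatMap]

omit hn in
lemma isChain_leveledDegrees (hγ : T.IsGreedyWeight γ) (hr : ∀ v, γ v ≤ γ r) :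
    (T.leveledDegrees c r n).IsChain (fun l l' => ∀ a ∈ l, ∀ b ∈ l', b ≤ a) := by
  rw [leveledDegrees, List.isChain_map, List.isChain_range]
  intro h _ a ha b hb
  obtain ⟨v, hv, rfl⟩ := List.mem_map.mp ha
  obtain ⟨q, hq, rfl⟩ := List.mem_map.mp hb
  rw [mem_levelList hT hc] at hv hq
  refine hγ.degree_le v q ?_ (hγ.le_of_level_succ hT hr (by omega))
  rintro rfl
  omega

omit [Fintype V] hT hc hn in
lemma levelList_eq_nil_of_le {n h : ℕ} (hnil : levelList c r n = []) (hle : n ≤ h) :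
    levelList c r h = [] := by
  induction h, hle using Nat.le_induction with
  | base => exact hnil
  | succ h _ ih => rw [levelList, ih, List.flatMap_nil]

omit hT hc hn in
/-- The vertex of the tree at a given position of a given level. -/
def levelVertex (a : LevelVertex (T.leveledDegrees c r n)) : V :=
  (levelList c r a.1)[(a.2 : ℕ)]'(a.2.2.trans_eq (length_get_leveledDegrees a.1))

omit hn in
lemma dist_levelVertex (a : LevelVertex (T.leveledDegrees c r n)) :
    T.dist (levelVertex a) r = a.1 :=
  (mem_levelList hT hc).mp (List.getElem_mem _)

lemma levelVertex_bijective (hnil : levelList c r n = []) :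
    Function.Bijective (levelVertex (T := T) (c := c) (r := r) (n := n)) := by
  constructor
  · intro a b hab
    have h1 : a.1 = b.1 := by
      rw [Fin.ext_iff, ← dist_levelVertex hT hc a, hab, dist_levelVertex hT hc b]
    obtain ⟨h, j⟩ := a
    obtain ⟨h', k⟩ := b
    dsimp only at h1
    subst h1
    have h2 := (nodup_levelList hT hc hn h).getElem_inj_iff.mp hab
    exact Sigma.ext rfl (heq_of_eq (Fin.ext h2))
  · intro v
    have hv : v ∈ levelList c r (T.dist v r) := (mem_levelList hT hc).mpr rfl
    have hlt : T.dist v r < n := by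
      by_contra! hle
      rw [levelList_eq_nil_of_le hnil hle] at hv
      exact List.not_mem_nil hv
    obtain ⟨j, hj, he⟩ := List.getElem_of_mem hv
    let h : Fin (T.leveledDegrees c r n).length :=
      ⟨T.dist v r, hlt.trans_eq length_leveledDegrees.symm⟩
    exact ⟨⟨h, ⟨j, hj.trans_eq (length_get_leveledDegrees h).symm⟩⟩, he⟩

lemma isGreedyChild_iff (a b : LevelVertex (T.leveledDegrees c r n)) :
    IsGreedyChild (T.leveledDegrees c r n) a b ↔ levelVertex b ∈ c (levelVertex a) := by
  have ha := dist_levelVertex hT hc a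
  have hb := dist_levelVertex hT hc b
  have hlev : levelVertex b ∈ c (levelVertex a) → (b.1 : ℕ) = a.1 + 1 := by
    intro h
    have := ((hc _ _).mp h).2
    omega
  rw [IsGreedyChild, map_childCount_take hT hc hn, map_childCount_take hT hc hn]
  constructor
  · rintro ⟨h1, h2⟩
    have hk := b.2.2.trans_eq (length_get_leveledDegrees b.1)
    have hv : levelVertex b = (levelList c r b.1)[(b.2 : ℕ)] := rfl
    rw [hv]
    simp only [h1] at hk ⊢
    exact (List.getElem_flatMap_mem_iff c (nodup_levelList hT hc hn (a.1 + 1)) _ hk).mpr h2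
  · intro h
    have h1 := hlev h
    refine ⟨h1, ?_⟩
    have hk := b.2.2.trans_eq (length_get_leveledDegrees b.1)
    have hv : levelVertex b = (levelList c r b.1)[(b.2 : ℕ)] := rfl
    rw [hv] at h
    simp only [h1] at hk h
    exact (List.getElem_flatMap_mem_iff c (nodup_levelList hT hc hn (a.1 + 1)) _ hk).mp h

lemma nonempty_iso_levelGreedyForest (hnil : levelList c r n = []) :
    Nonempty (T ≃g levelGreedyForest (T.leveledDegrees c r n)) := by
  have hb := levelVertex_bijective hT hc hn hnil
  refine ⟨RelIso.symm ⟨Equiv.ofBijective _ hb, fun {a b} => ?_⟩⟩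
  rw [Equiv.ofBijective_apply, Equiv.ofBijective_apply, adj_iff_mem_or_mem hT hc,
    levelGreedyForest, fromRel_adj, isGreedyChild_iff hT hc hn, isGreedyChild_iff hT hc hn,
    ← adj_iff_mem_or_mem hT hc]
  exact ⟨fun h => ⟨fun hab => h.ne (congrArg _ hab), h⟩, fun h => h.2⟩

end

/-- A tree with a greedy weight is a greedy tree. -/
theorem IsGreedyWeight.isGreedyTree [Fintype V] (hγ : T.IsGreedyWeight γ) (hT : T.IsTree) :
    IsGreedyTree T := by
  classical
  have := hT.connected.nonempty
  obtain ⟨r, hr⟩ := Finite.exists_max γ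
  have hex : ∀ u, ∃ l : List V, (∀ v, v ∈ l ↔ T.Adj u v ∧ T.dist v r = T.dist u r + 1) ∧
      l.Nodup ∧ l.Pairwise (fun a b => γ b ≤ γ a) := by
    intro u
    let R : V → V → Prop := fun a b => γ b ≤ γ a
    have : Std.Total R := ⟨fun a b => le_total (γ b) (γ a)⟩
    have : IsTrans V R := ⟨fun a b d hab hbd => le_trans hbd hab⟩
    let s : Finset V := univ.filter fun v => T.Adj u v ∧ T.dist v r = T.dist u r + 1
    refine ⟨s.toList.insertionSort R, fun v => ?_, ?_, List.pairwise_insertionSort R _⟩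
    · rw [List.mem_insertionSort, mem_toList, mem_filter, and_iff_right (mem_univ v)]
    · exact (List.perm_insertionSort R _).nodup_iff.mpr s.nodup_toList
  choose c hc hn hs using hex
  -- Depths are bounded; the first empty level gives the number of levels.
  have hnil : ∃ n, levelList c r n = [] := by
    obtain ⟨m, hm⟩ := (Set.finite_range fun v => T.dist v r).bddAbove
    refine ⟨m + 1, List.eq_nil_iff_forall_not_mem.mpr fun v hv => ?_⟩
    rw [mem_levelList hT hc] at hv
    have := hm ⟨v, rfl⟩
    dsimp only at this
    omega
  have h0 := Nat.find_spec hnil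
  have h1 : ∀ h < Nat.find hnil, levelList c r h ≠ [] := fun h hh => Nat.find_min hnil hh
  exact ⟨hT, _, isLeveledDegreeSequence_leveledDegrees hT hc hn hγ hs h1 h0,
    isChain_leveledDegrees hT hc hγ hr, nonempty_iso_levelGreedyForest hT hc hn h0⟩

end SimpleGraph

/-! ### Uniqueness of greedy trees. -/

namespace List

lemma exists_sum_map_take_le_lt {α : Type*} (g : α → ℕ) {l : List α} {k : ℕ}
    (hk : k < (l.map g).sum) : ∃ j < l.length, ((l.take j).map g).sum ≤ k ∧
      k < ((l.take (j + 1)).map g).sum := by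
  classical
  have hex : ∃ j, k < ((l.take j).map g).sum := ⟨l.length, by rwa [take_length]⟩
  have h1 := Nat.find_spec hex
  obtain ⟨j, hj⟩ : ∃ j, Nat.find hex = j + 1 := by
    refine Nat.exists_eq_succ_of_ne_zero fun h0 => ?_
    rw [h0, take_zero, map_nil, sum_nil] at h1
    exact Nat.not_lt_zero k h1
  have h2 := Nat.find_min hex (m := j) (by omega)
  rw [hj] at h1
  refine ⟨j, ?_, not_lt.mp h2, h1⟩
  by_contra! hle
  rw [take_of_length_le hle] at h2
  exact h2 hk

lemma sum_map_take_mono {α : Type*} (g : α → ℕ) (l : List α) {i j : ℕ} (hij : i ≤ j) :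
    ((l.take i).map g).sum ≤ ((l.take j).map g).sum :=
  (((take_prefix_take_left (l := l) hij).sublist).map g).sum_le_sum (fun _ _ => Nat.zero_le _)

lemma eq_of_sum_map_take {α : Type*} (g : α → ℕ) {l : List α} {i j k : ℕ}
    (hi : ((l.take i).map g).sum ≤ k) (hi' : k < ((l.take (i + 1)).map g).sum)
    (hj : ((l.take j).map g).sum ≤ k) (hj' : k < ((l.take (j + 1)).map g).sum) : i = j := by
  rcases lt_trichotomy i j with h | h | h
  · have := sum_map_take_mono g l (i := i + 1) (j := j) h
    omega
  · exact h
  · have := sum_map_take_mono g l (i := j + 1) (j := i) h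
    omega

/-- A list of nonempty lists is determined by its concatenation, the length of its first member and
a rule giving the length of each further member. -/
lemma eq_of_flatten_eq {α : Type*} (f : ℕ → List α → ℕ) {L L' : List (List α)} (h : ℕ)
    (hL : ∀ l ∈ L, l ≠ []) (hL' : ∀ l ∈ L', l ≠ [])
    (hf : ∀ i (hi : i < L.length), (L.getD (i + 1) []).length = f (h + i) L[i])
    (hf' : ∀ i (hi : i < L'.length), (L'.getD (i + 1) []).length = f (h + i) L'[i])
    (h0 : (L.getD 0 []).length = (L'.getD 0 []).length) (he : L.flatten = L'.flatten) :
    L = L' := by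
  induction L generalizing L' h with
  | nil =>
    cases L' with
    | nil => rfl
    | cons l' t' =>
      rw [flatten_nil, flatten_cons] at he
      exact absurd (append_eq_nil_iff.mp he.symm).1 (hL' l' mem_cons_self)
  | cons l t ih =>
    cases L' with
    | nil =>
      rw [flatten_nil, flatten_cons] at he
      exact absurd (append_eq_nil_iff.mp he).1 (hL l mem_cons_self)
    | cons l' t' =>
      rw [flatten_cons, flatten_cons] at he
      obtain ⟨h1, h2⟩ := append_inj he h0
      subst h1
      have h3 := hf 0 (by simp)
      have h4 := hf' 0 (by simp)
      -- The offset tracks the true level, since `childCount` treats the root level differently.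
      rw [ih (h + 1) (fun l hl => hL l (mem_cons_of_mem _ hl))
        (fun l hl => hL' l (mem_cons_of_mem _ hl))
        (fun i hi => by
          have := hf (i + 1) (by simpa using hi)
          rw [add_assoc, add_comm 1 i]
          simpa using this)
        (fun i hi => by
          have := hf' (i + 1) (by simpa using hi)
          rw [add_assoc, add_comm 1 i]
          simpa using this)
        (by simpa using h3.trans h4.symm) h2]

lemma pairwise_flatten_of_isChain {L : List (List ℕ)} (hne : ∀ l ∈ L, l ≠ [])
    (hl : ∀ l ∈ L, l.Pairwise (fun a b => b ≤ a))
    (hc : L.IsChain (fun l l' => ∀ a ∈ l, ∀ b ∈ l', b ≤ a)) :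
    L.flatten.Pairwise (fun a b => b ≤ a) := by
  rw [pairwise_flatten]
  refine ⟨hl, ?_⟩
  clear hl
  induction L with
  | nil => exact Pairwise.nil
  | cons l t ih =>
    have h1 := ih (fun l hl => hne l (mem_cons_of_mem _ hl)) hc.tail
    refine pairwise_cons.mpr ⟨?_, h1⟩
    cases t with
    | nil => simp
    | cons m t =>
      have h2 := (isChain_cons_cons.mp hc).1
      intro m' hm' a ha b hb
      rcases mem_cons.mp hm' with rfl | hm'
      · exact h2 a ha b hb
      · obtain ⟨e, he⟩ := exists_mem_of_ne_nil m (hne m (by simp))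
        exact ((pairwise_cons.mp h1).1 m' hm' e he b hb).trans (h2 a ha e he)

end List

lemma degreeSequence_eq_of_iso {V W : Type*} [Fintype V] [Fintype W] {G : SimpleGraph V}
    {H : SimpleGraph W} (e : G ≃g H) : degreeSequence G = degreeSequence H := by
  classical
  unfold degreeSequence
  rw [← Multiset.map_univ_val_equiv e.toEquiv, Multiset.map_map]
  refine Multiset.map_congr rfl fun v _ => ?_
  rw [Function.comp_apply]
  exact (e.degree_eq v).symm

section LevelGreedyForest
open Finset

variable {L : List (List ℕ)}

lemma IsGreedyChild.level_eq {a b : LevelVertex L} (h : IsGreedyChild L a b) :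
    (b.1 : ℕ) = a.1 + 1 := h.1

lemma levelVertex_ext {a b : LevelVertex L} (h1 : (a.1 : ℕ) = b.1) (h2 : (a.2 : ℕ) = b.2) :
    a = b := by
  obtain ⟨⟨h, hh⟩, j⟩ := a
  obtain ⟨⟨h', hh'⟩, k⟩ := b
  dsimp only at h1
  subst h1
  exact Sigma.ext rfl (heq_of_eq (Fin.ext h2))

lemma levelGreedyForest_adj {a b : LevelVertex L} :
    (levelGreedyForest L).Adj a b ↔ IsGreedyChild L a b ∨ IsGreedyChild L b a := by
  rw [levelGreedyForest, SimpleGraph.fromRel_adj, and_iff_right_iff_imp]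
  rintro h rfl
  rcases h with h | h <;> have := h.level_eq <;> omega

open Classical in
lemma levelGreedyForest_degree (a : LevelVertex L) : (levelGreedyForest L).degree a =
    #(univ.filter fun b => IsGreedyChild L a b) + #(univ.filter fun b => IsGreedyChild L b a) := by
  rw [← card_union_of_disjoint, ← SimpleGraph.card_neighborFinset_eq_degree]
  · congr 1
    ext b
    rw [SimpleGraph.mem_neighborFinset, levelGreedyForest_adj, mem_union, mem_filter, mem_filter,
      and_iff_right (mem_univ b), and_iff_right (mem_univ b)]
  · rw [disjoint_filter]
    intro b _ h1 h2
    have := h1.level_eq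
    have := h2.level_eq
    omega

namespace IsLeveledDegreeSequence

variable (hL : IsLeveledDegreeSequence L)
include hL

open Classical in
lemma card_children (a : LevelVertex L) :
    #(univ.filter fun b => IsGreedyChild L a b) = childCount a.1 ((L.get a.1).get a.2) := by
  have h1 := List.sum_map_take_succ (childCount a.1) a.2.2
  have h2 := List.sum_map_take_mono (childCount a.1) (L.get a.1)
    (i := a.2 + 1) (j := (L.get a.1).length) a.2.2
  rw [List.take_length, ← hL.length_next a.1] at h2
  calc _ = #(Ico (((L.get a.1).take (a.2 : ℕ)).map (childCount a.1)).sum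
        (((L.get a.1).take ((a.2 : ℕ) + 1)).map (childCount a.1)).sum) := by
        refine card_bij (fun b _ => (b.2 : ℕ)) ?_ ?_ ?_
        · intro b hb
          exact mem_Ico.mpr (mem_filter.mp hb).2.2
        · intro b hb b' hb' he
          have h3 := (mem_filter.mp hb).2.level_eq
          have h4 := (mem_filter.mp hb').2.level_eq
          exact levelVertex_ext (by omega) he
        · intro k hk
          rw [mem_Ico] at hk
          have hlt : (a.1 : ℕ) + 1 < L.length := by
            by_contra hge
            rw [List.getD_eq_default _ _ (not_lt.mp hge), List.length_nil] at h2
            omega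
          rw [List.getD_eq_getElem _ _ hlt] at h2
          exact ⟨⟨⟨a.1 + 1, hlt⟩, ⟨k, by rw [List.get_eq_getElem]; exact hk.2.trans_le h2⟩⟩,
            mem_filter.mpr ⟨mem_univ _, rfl, hk⟩, rfl⟩
    _ = _ := by
        rw [Nat.card_Ico, h1, Nat.add_sub_cancel_left]
        rfl

-- The position intervals assigned to the vertices of one level partition the next level.
open Classical in
lemma card_parents (b : LevelVertex L) :
    #(univ.filter fun a => IsGreedyChild L a b) = if (b.1 : ℕ) = 0 then 0 else 1 := by
  split_ifs with h0
  · rw [card_eq_zero, filter_eq_empty_iff]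
    intro a _ h
    have := h.level_eq
    omega
  · obtain ⟨h, hh⟩ := Nat.exists_eq_succ_of_ne_zero h0
    have hlt : h + 1 < L.length := by
      have := b.1.2
      omega
    let h' : Fin L.length := ⟨h, by omega⟩
    have h1 := hL.length_next h'
    have h2 : L.getD (h + 1) [] = L.get b.1 := by
      rw [List.getD_eq_getElem _ _ hlt, List.get_eq_getElem]
      congr 1
      exact hh.symm
    have hk : (b.2 : ℕ) < ((L.get h').map (childCount h)).sum := by
      rw [← h1, h2]
      exact b.2.2
    obtain ⟨j, hj, hj1, hj2⟩ := List.exists_sum_map_take_le_lt _ hk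
    rw [card_eq_one]
    refine ⟨⟨h', ⟨j, hj⟩⟩, ?_⟩
    ext a
    rw [mem_filter, mem_singleton, and_iff_right (mem_univ a)]
    constructor
    · intro ha
      have h3 : a.1 = h' := Fin.ext (by
        have := ha.level_eq
        change (a.1 : ℕ) = h
        omega)
      obtain ⟨i, k⟩ := a
      dsimp only at h3
      subst h3
      exact levelVertex_ext rfl (List.eq_of_sum_map_take _ ha.2.1 ha.2.2 hj1 hj2)
    · rintro rfl
      exact ⟨hh, hj1, hj2⟩

open Classical in
lemma degree_eq (a : LevelVertex L) : (levelGreedyForest L).degree a = (L.get a.1).get a.2 := by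
  rw [levelGreedyForest_degree, hL.card_children, hL.card_parents, childCount]
  split_ifs with h
  · rfl
  -- Positivity makes the truncated `d - 1` plus one parent equal to `d`.
  · have := hL.degree_pos a.1 (Nat.pos_of_ne_zero h) _ (List.get_mem _ a.2)
    omega

lemma degreeSequence_eq : degreeSequence (levelGreedyForest L) = (L.flatten : Multiset ℕ) := by
  classical
  have h1 : degreeSequence (levelGreedyForest L) =
      (univ : Finset (LevelVertex L)).val.map (fun a => (L.get a.1).get a.2) :=
    Multiset.map_congr rfl fun a _ => hL.degree_eq a
  rw [h1, ← univ_sigma_univ]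
  change ((univ : Finset (Fin L.length)).val.sigma fun h =>
    (univ : Finset (Fin (L.get h).length)).val).map (fun a => (L.get a.1).get a.2) = _
  rw [Multiset.sigma, Multiset.map_bind]
  simp only [Multiset.map_map, Function.comp_def]
  have h2 : ∀ h : Fin L.length, (univ : Finset (Fin (L.get h).length)).val.map
      (fun j => (L.get h).get j) = ((L.get h : List ℕ) : Multiset ℕ) := by
    intro h
    rw [Fin.univ_val_map, List.ofFn_get]
  rw [Multiset.bind_congr fun h _ => h2 h, Multiset.bind, Fin.univ_val_map, ← Multiset.coe_join]
  congr 2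
  refine List.ext_getElem (by simp) fun i hi hi' => by simp

/-- Each vertex below the roots contributes one edge to its parent, so edges number vertices minus
roots; in a tree this forces one root. -/
lemma length_root_level (hT : (levelGreedyForest L).IsTree) : (L.getD 0 []).length = 1 := by
  classical
  have h1 := (SimpleGraph.isTree_iff_connected_and_card.mp hT).2
  have h2 := (levelGreedyForest L).sum_degrees_eq_twice_card_edges
  rw [Nat.card_eq_fintype_card, Nat.card_eq_fintype_card, ← SimpleGraph.edgeFinset_card] at h1
  have h3 : ∑ a : LevelVertex L, #(univ.filter fun b => IsGreedyChild L a b) =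
      ∑ b : LevelVertex L, #(univ.filter fun a => IsGreedyChild L a b) :=
    sum_card_bipartiteAbove_eq_sum_card_bipartiteBelow _
  have h4 : ∑ b : LevelVertex L, #(univ.filter fun a => IsGreedyChild L a b) =
      #(univ.filter fun b : LevelVertex L => ¬ (b.1 : ℕ) = 0) := by
    rw [card_filter, sum_congr rfl fun b _ => hL.card_parents b]
    exact sum_congr rfl fun b _ => by split_ifs <;> rfl
  rw [sum_congr rfl fun a _ => levelGreedyForest_degree a, sum_add_distrib, h3, h4] at h2
  have h5 := card_filter_add_card_filter_not (s := (univ : Finset (LevelVertex L)))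
    (fun b => (b.1 : ℕ) = 0)
  rw [card_univ] at h5
  obtain ⟨a, ha⟩ := card_eq_one.mp (show #(univ.filter fun b : LevelVertex L => (b.1 : ℕ) = 0) = 1
    by omega)
  have hpos : 0 < L.length := Fin.pos a.1
  have h6 : ∀ j : Fin (L.get ⟨0, hpos⟩).length, (⟨⟨0, hpos⟩, j⟩ : LevelVertex L) = a := by
    intro j
    rw [← mem_singleton, ← ha]
    exact mem_filter.mpr ⟨mem_univ _, rfl⟩
  rw [List.getD_eq_getElem _ _ hpos]
  have h7 := List.length_pos_of_ne_nil (hL.level_ne_nil _ (List.getElem_mem hpos))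
  by_contra hne
  have h8 := (h6 ⟨0, h7⟩).trans (h6 ⟨1, by rw [List.get_eq_getElem]; dsimp only; omega⟩).symm
  have h9 := congrArg (fun b : LevelVertex L => (b.2 : ℕ)) h8
  exact zero_ne_one h9

end IsLeveledDegreeSequence

/-- Greedy trees with the same degree sequence are isomorphic. -/
theorem IsGreedyTree.nonempty_iso {V W : Type*} [Fintype V] [Fintype W] {G : SimpleGraph V}
    {H : SimpleGraph W} (hG : IsGreedyTree G) (hH : IsGreedyTree H)
    (h : degreeSequence G = degreeSequence H) : Nonempty (G ≃g H) := by
  obtain ⟨hGt, L, hL, hLc, ⟨e⟩⟩ := hG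
  obtain ⟨hHt, L', hL', hLc', ⟨e'⟩⟩ := hH
  rw [degreeSequence_eq_of_iso e, degreeSequence_eq_of_iso e', hL.degreeSequence_eq,
    hL'.degreeSequence_eq, Multiset.coe_eq_coe] at h
  have h1 := List.pairwise_flatten_of_isChain hL.level_ne_nil hL.level_nonincreasing hLc
  have h2 := List.pairwise_flatten_of_isChain hL'.level_ne_nil hL'.level_nonincreasing hLc'
  have h3 : L.flatten = L'.flatten :=
    h.eq_of_pairwise (fun a b _ _ hab hba => le_antisymm hba hab) h1 h2
  have h4 : L = L' := by
    refine List.eq_of_flatten_eq (fun i l => (l.map (childCount i)).sum) 0 hL.level_ne_nil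
      hL'.level_ne_nil (fun i hi => ?_) (fun i hi => ?_) ?_ h3
    · rw [zero_add]
      exact hL.length_next ⟨i, hi⟩
    · rw [zero_add]
      exact hL'.length_next ⟨i, hi⟩
    · rw [hL.length_root_level (e.isTree_iff.mp hGt), hL'.length_root_level (e'.isTree_iff.mp hHt)]
  subst h4
  exact ⟨e.trans e'.symm⟩

end LevelGreedyForest

/-! ### Comparison of characteristic polynomials. -/

namespace SimpleGraph
open Finset Matrix

variable {V W : Type*} [Fintype V] [Fintype W] {T : SimpleGraph V} {G : SimpleGraph W} {x : ℝ}

lemma graphCharpoly_eq_of_iso (e : T ≃g G) : graphCharpoly T = graphCharpoly G := by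
  classical
  unfold graphCharpoly
  rw [← e.reindex_adjMatrix ℝ, charpoly_reindex]

open Classical in
lemma isHermitian_scalar_sub_adjMatrix (T : SimpleGraph V) (x : ℝ) :
    (Matrix.scalar V x - T.adjMatrix ℝ).IsHermitian := by
  refine IsHermitian.sub ?_ ?_
  · rw [Matrix.scalar_apply]
    exact isHermitian_diagonal _
  · rw [IsHermitian, conjTranspose_eq_transpose_of_trivial, transpose_adjMatrix]

-- An eigenvalue `μ` of `x - A` gives the root `x - μ` of the characteristic polynomial.
open Classical in
lemma posDef_of_forall_root_lt (h : ∀ y, (graphCharpoly T).IsRoot y → y < x) :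
    (Matrix.scalar V x - T.adjMatrix ℝ).PosDef := by
  have hH := T.isHermitian_scalar_sub_adjMatrix x
  rw [hH.posDef_iff_eigenvalues_pos]
  intro i
  have h1 := hH.eigenvalues_mem_spectrum_real i
  rw [mem_spectrum_iff_isRoot_charpoly, Polynomial.IsRoot, eval_charpoly] at h1
  have h2 : Matrix.scalar V (hH.eigenvalues i) - (Matrix.scalar V x - T.adjMatrix ℝ) =
      -(Matrix.scalar V (x - hH.eigenvalues i) - T.adjMatrix ℝ) := by
    rw [map_sub]
    abel
  rw [h2, det_neg, ← eval_graphCharpoly] at h1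
  have := h _ ((mul_eq_zero.mp h1).resolve_left (pow_ne_zero _ (by norm_num)))
  linarith

open Classical in
lemma eval_graphCharpoly_pos (h : ∀ y, (graphCharpoly T).IsRoot y → y < x) :
    0 < (graphCharpoly T).eval x := by
  rw [eval_graphCharpoly]
  exact (posDef_of_forall_root_lt h).det_pos

lemma lt_of_isRoot_of_graphSpectralRadius_lt (h : graphSpectralRadius T < ENNReal.ofReal x) {y : ℝ}
    (hy : (graphCharpoly T).IsRoot y) : y < x := by
  classical
  have h1 : y ∈ spectrum ℝ (T.adjMatrix ℝ) := mem_spectrum_iff_isRoot_charpoly.mpr hy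
  have h2 : (‖y‖₊ : ENNReal) ≤ graphSpectralRadius T :=
    le_iSup₂ (f := fun (k : ℝ) (_ : k ∈ spectrum ℝ (T.adjMatrix ℝ)) => (‖k‖₊ : ENNReal)) y h1
  have h3 := h2.trans_lt h
  rw [← enorm_eq_nnnorm, ← ofReal_norm,
    ENNReal.ofReal_lt_ofReal_iff_of_nonneg (norm_nonneg y)] at h3
  exact (Real.le_norm_self y).trans_lt h3

/-- The eigenvalues of the trees on `V` with degree sequence `D`. -/
def treeEigenvalues (V : Type*) [Fintype V] (D : Multiset ℕ) : Set ℝ :=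
  {y | ∃ S : SimpleGraph V, S.IsTree ∧ degreeSequence S = D ∧ (graphCharpoly S).IsRoot y}

lemma finite_treeEigenvalues (V : Type*) [Fintype V] (D : Multiset ℕ) :
    (treeEigenvalues V D).Finite := by
  classical
  refine (Set.finite_iUnion fun S : SimpleGraph V => (graphCharpoly S).roots.toFinset.finite_toSet
    ).subset ?_
  rintro y ⟨S, _, _, hy⟩
  refine Set.mem_iUnion.mpr ⟨S, ?_⟩
  have hne : graphCharpoly S ≠ 0 := (charpoly_monic _).ne_zero
  rw [mem_coe, Multiset.mem_toFinset, Polynomial.mem_roots hne]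
  exact hy

lemma exists_isCharpolyMinimizer {D : Multiset ℕ} (hT : T.IsTree) (hD : degreeSequence T = D)
    (hx : ∀ y ∈ treeEigenvalues V D, y < x) :
    ∃ S : SimpleGraph V, degreeSequence S = D ∧ S.IsCharpolyMinimizer x := by
  obtain ⟨S, ⟨hS, hSD⟩, hmin⟩ := Set.exists_min_image
    {S : SimpleGraph V | S.IsTree ∧ degreeSequence S = D} (fun S => (graphCharpoly S).eval x)
    (Set.toFinite _) ⟨T, hT, hD⟩
  exact ⟨S, hSD, hS, posDef_of_forall_root_lt fun y hy => hx y ⟨S, hS, hSD, hy⟩,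
    fun S' hS' hD' => hmin S' ⟨hS', hD'.trans hSD⟩⟩

lemma IsCharpolyMinimizer.isGreedyTree (h : T.IsCharpolyMinimizer x) : IsGreedyTree T :=
  h.isGreedyWeight.isGreedyTree h.isTree

/-- A minimizer is greedy, hence isomorphic to `G`. In the equality case `T` is itself a minimizer.
-/
lemma eval_le_of_forall_treeEigenvalues_lt {D : Multiset ℕ} (hT : T.IsTree)
    (hD : degreeSequence T = D) (hG : IsGreedyTree G) (hGD : degreeSequence G = D)
    (hx : ∀ y ∈ treeEigenvalues V D, y < x) :
    (graphCharpoly G).eval x ≤ (graphCharpoly T).eval x ∧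
      ((graphCharpoly T).eval x = (graphCharpoly G).eval x → Nonempty (T ≃g G)) := by
  obtain ⟨S, hSD, hS⟩ := exists_isCharpolyMinimizer hT hD hx
  obtain ⟨e⟩ := hS.isGreedyTree.nonempty_iso hG (hSD.trans hGD.symm)
  rw [← graphCharpoly_eq_of_iso e]
  refine ⟨hS.le T hT (hD.trans hSD.symm), fun he => ?_⟩
  have hmin : T.IsCharpolyMinimizer x :=
    ⟨hT, posDef_of_forall_root_lt fun y hy => hx y ⟨T, hT, hD, hy⟩,
      fun S' hS' hD' => he.le.trans (hS.le S' hS' (hD'.trans (hD.trans hSD.symm)))⟩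
  exact hmin.isGreedyTree.nonempty_iso hG (hD.trans hGD.symm)

/-- The eigenvalues of a greedy tree bound those of all trees with the same degree sequence. -/
lemma treeEigenvalues_lt_of_isGreedyTree {D : Multiset ℕ} (hG : IsGreedyTree G)
    (hGD : degreeSequence G = D) (hx : ∀ y, (graphCharpoly G).IsRoot y → y < x) :
    ∀ y ∈ treeEigenvalues V D, y < x := by
  by_contra! hc
  obtain ⟨y, hy, hxy⟩ := hc
  obtain ⟨m, hm, hmax⟩ := Set.exists_max_image _ id (finite_treeEigenvalues V D) ⟨y, hy⟩
  obtain ⟨S, hS, hSD, hroot⟩ := hm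
  -- The comparison is known for `z > m`, where `m` is the largest tree eigenvalue, and extends to
  -- `m` by continuity.
  have hle : (graphCharpoly G).eval m ≤ (graphCharpoly S).eval m := by
    refine le_of_tendsto_of_tendsto (b := nhdsWithin m (Set.Ioi m))
      (graphCharpoly G).continuous.continuousWithinAt
      (graphCharpoly S).continuous.continuousWithinAt ?_
    filter_upwards [self_mem_nhdsWithin] with z hz
    exact (eval_le_of_forall_treeEigenvalues_lt hS hSD hG hGD
      fun y hy => (hmax y hy).trans_lt hz).1
  have hpos := eval_graphCharpoly_pos fun z hz => (hx z hz).trans_le (hxy.trans (hmax y hy))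
  rw [hroot.eq_zero] at hle
  exact absurd hle (not_le.mpr hpos)

end SimpleGraph

theorem mainTheorem8 {V : Type*} [Fintype V] (D : Multiset ℕ) (T : SimpleGraph V)
    (hT : T.IsTree) (hD : degreeSequence T = D) :
    (∃ G : SimpleGraph V, IsGreedyTree G ∧ degreeSequence G = D) ∧
    ∀ {W : Type*} [Fintype W] (G : SimpleGraph W),
      IsGreedyTree G → degreeSequence G = D →
      ∀ x : ℝ, graphSpectralRadius G < ENNReal.ofReal x →
        (graphCharpoly G).eval x ≤ (graphCharpoly T).eval x ∧
        ((graphCharpoly T).eval x = (graphCharpoly G).eval x → Nonempty (T ≃g G)) := by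
  constructor
  -- For existence, any point above all tree eigenvalues will do.
  · obtain ⟨b, hb⟩ := (SimpleGraph.finite_treeEigenvalues V D).bddAbove
    obtain ⟨S, hSD, hS⟩ := SimpleGraph.exists_isCharpolyMinimizer hT hD (x := b + 1)
      fun y hy => (hb hy).trans_lt (lt_add_one b)
    exact ⟨S, hS.isGreedyTree, hSD⟩
  · intro W _ G hG hGD x hx
    exact SimpleGraph.eval_le_of_forall_treeEigenvalues_lt hT hD hG hGD
      (SimpleGraph.treeEigenvalues_lt_of_isGreedyTree hG hGD
        fun y hy => SimpleGraph.lt_of_isRoot_of_graphSpectralRadius_lt hx hy)
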